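/- Let $R$ be a countable (not necessarily commutative) ring with $1\neq 0$, and let $\bigoplus_\omega R$ be the free left $R$-module of countably infinite rank. A tagged left $R$-module is a structure $(M,M_n)_{n\in\omega}$ in the language $\{0,+\}\cup\{r\cdot : r\in R\}\cup\{U_n:n\in\omega\}$, where $M$ is a left $R$-module and each unary predicate $U_n$ is interpreted as a submodule $M_n\subseteq M$. It is called free-like if $M\cong\bigoplus_\omega R$ and, for every $n\in\omega$, both $M_n$ and $M/M_n$ are isomorphic to $\bigoplus_\omega R$ as left $R$-modules. For a countable first-order language $L$, let $\mathrm{Str}_L$ be the Polish space of $L$-structures with universe $\omega$. A Borel class of countable $L$-structures is an isomorphism-invariant Borel subset of $\mathrm{Str}_L$. (Equivalently, it is the set of models with universe $\omega$ of an $L_{\omega_1\omega}$-sentence.) A Borel class $C$ is Borel reducible to a Borel class $D$, possibly in another countable language, if there is a Borel map $f:C\to D$ such that for all $S,T\in C$, $f(S)\cong f(T)$ if and only if $S\cong T$. A Borel class is Borel complete if every Borel class of countable structures, in any countable language, is Borel reducible to it. Then the class of free-like tagged left $R$-modules with universe $\omega$ is a Borel class, and it is Borel complete. -/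

import Mathlib

namespace TaggedModules

universe u v u' v'

/-! ### Spaces of countable structures and Borel reducibility -/

/-- The space of all `L`-structures with universe `ω`. -/
abbrev Str (L : FirstOrder.Language.{u, v}) : Type (max u v) := L.Structure ℕ

/-- The natural topology on the space of `L`-structures with universe `ω`: truth of `f(x) = y`,
of `r(x)` and of `¬ r(x)` are basic (clopen) conditions, for all tuples `x` and elements `y`. -/
instance instTopologicalSpaceStr (L : FirstOrder.Language.{u, v}) : TopologicalSpace (Str L) :=
  TopologicalSpace.generateFrom
    ({A | ∃ (n : ℕ) (f : L.Functions n) (x : Fin n → ℕ) (y : ℕ),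
        A = {S : Str L | S.funMap f x = y}} ∪
     {A | ∃ (n : ℕ) (r : L.Relations n) (x : Fin n → ℕ), A = {S : Str L | S.RelMap r x}} ∪
     {A | ∃ (n : ℕ) (r : L.Relations n) (x : Fin n → ℕ), A = {S : Str L | ¬ S.RelMap r x}})

/-- The Borel `σ`-algebra of the natural topology. -/
instance instMeasurableSpaceStr (L : FirstOrder.Language.{u, v}) : MeasurableSpace (Str L) :=
  borel (Str L)

/-- Isomorphism of `L`-structures with universe `ω`. -/
def StrIso {L : FirstOrder.Language.{u, v}} (S T : Str L) : Prop :=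
  Nonempty (@FirstOrder.Language.Equiv L ℕ ℕ S T)

/-- A Borel class of countable structures: a Borel set of structures with universe `ω` that is
closed under isomorphism. -/
def IsBorelClass {L : FirstOrder.Language.{u, v}} (C : Set (Str L)) : Prop :=
  MeasurableSet C ∧ ∀ S T : Str L, StrIso S T → S ∈ C → T ∈ C

/-- `C` is Borel reducible to `D`: there is a Borel map from `C` to `D` which preserves and
reflects isomorphism. -/
def BorelReducible {L : FirstOrder.Language.{u, v}} {L' : FirstOrder.Language.{u', v'}}
    (C : Set (Str L)) (D : Set (Str L')) : Prop :=
  ∃ f : C → D, Measurable f ∧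
    ∀ S T : C, StrIso (f S : Str L') (f T : Str L') ↔ StrIso (S : Str L) (T : Str L)

/-- `D` is Borel complete: it is a maximal Borel class with respect to Borel reducibility, that is,
every Borel class of countable structures in a countable language is Borel reducible to it. -/
def BorelComplete {L' : FirstOrder.Language.{u', v'}} (D : Set (Str L')) : Prop :=
  IsBorelClass D ∧
    ∀ (L : FirstOrder.Language.{0, 0}), Countable L.Symbols →
      ∀ C : Set (Str L), IsBorelClass C → BorelReducible C D

/-! ### Tagged modules -/

/-- The function symbols `0`, `+` and `r · _` (for `r ∈ R`) of the language of `R`-modules. -/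
inductive ModFunc (R : Type u) : ℕ → Type u
  | zero : ModFunc R 0
  | add : ModFunc R 2
  | smul (r : R) : ModFunc R 1

/-- Countably many unary predicate symbols. -/
inductive TagRel : ℕ → Type
  | tag (n : ℕ) : TagRel 1

/-- The language of tagged left `R`-modules. -/
def taggedLanguage (R : Type u) : FirstOrder.Language.{u, 0} where
  Functions := ModFunc R
  Relations := TagRel

/-- The tagged left `R`-module `(V, M₀, M₁, …)` as a structure in the language of tagged left
`R`-modules. -/
abbrev taggedStructure {R : Type u} [Ring R] {V : Type v} [AddCommGroup V] [Module R V]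
    (M : ℕ → Submodule R V) : (taggedLanguage R).Structure V where
  funMap {_} f := match f with
    | ModFunc.zero => fun _ => 0
    | ModFunc.add => fun x => x 0 + x 1
    | ModFunc.smul r => fun x => r • x 0
  RelMap {_} s := match s with
    | TagRel.tag n => fun x => x 0 ∈ M n

/-- The tagged left `R`-module `(V, M₀, M₁, …)` is free-like: `V`, all the `Mₙ` and all the
quotients `V / Mₙ` are isomorphic to the direct sum of countably infinitely many copies of `R`. -/
def IsFreeLike {R : Type u} [Ring R] {V : Type v} [AddCommGroup V] [Module R V]
    (M : ℕ → Submodule R V) : Prop :=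
  Nonempty (V ≃ₗ[R] (ℕ →₀ R)) ∧
    ∀ n, Nonempty (M n ≃ₗ[R] (ℕ →₀ R)) ∧ Nonempty ((V ⧸ M n) ≃ₗ[R] (ℕ →₀ R))

/-- The class of free-like tagged left `R`-modules with universe `ω`: all structures with universe
`ω` that are isomorphic to `(V, M₀, M₁, …)` for some free-like tagged left `R`-module. -/
def freeLikeClass (R : Type u) [Ring R] : Set (Str (taggedLanguage R)) :=
  {S | ∃ (V : Type u) (_ : AddCommGroup V) (_ : Module R V) (M : ℕ → Submodule R V),
    IsFreeLike M ∧
      Nonempty (@FirstOrder.Language.Equiv (taggedLanguage R) V ℕ (taggedStructure M) S)}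

end TaggedModules

namespace TaggedModules

universe u v w

/-! Borelness: isomorphism with a fixed countable structure is a Borel condition, by a Scott
sentence. Being free-like means that countably many structures (the module, each tag, each quotient)
are isomorphic to one fixed countable free module. Quotients stay on the universe `ω` by reading
equality as a congruence. `measurableSet_isPresentation` handles all these cases at once.

Completeness: a structure is coded by the family `P` of graphs of its symbols, so isomorphism
becomes the existence of a permutation `σ` of `ω` carrying one family of sets of finite sequences to
another. The permutation must be visible in a countable module, so it is represented as a limit of
elements `η n` of a countable group `H` with a homomorphism onto a dense group of permutations. The
free module has, for every `n`, a copy of `H` and a copy of `H ⊕ List ℕ`, together with limit points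
`lim l`. The tag `graph n x r` links `grp n h` with `r` times the translate of `pt n x` by `h`,
`base n` isolates the `n`-th block of points, `proj n` is the kernel of the projection onto that
block which sends `lim l` to `pt n l`, and `code j` records `P j` on the limit points.

From `σ` to an isomorphism: choose `η n` in `H` converging to `σ`, translate the `n`-th blocks by `η
n`, and send `lim l` to `lim (σ l)` plus a finite correction, finite because `η n` and `σ`
eventually agree on `l` (`exists_linearEquiv_of_perm`).

From an isomorphism to `σ`: the graph tags force it to act on the `n`-th points as a unit of the
group ring of `H` over the center of `R` (`apply_single_pt`, `apply_grp_mem_center`). Modulo a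
maximal ideal of the center this unit lives over a field, and there it is a scalar times some `η n`,
provided `H` has two unique products. The image of `lim l` has finite support, so `proj n` forces `η
n` to stabilise on `l` (`eventually_map_eq`). The limit is `σ`, and `code j` shows that it respects
the families.

A dense group of permutations may have torsion, hence nontrivial units. Therefore `H` is taken
inside the left-orderable automorphism group of a countable order with densely interleaved colours,
acting on the colours (`exists_dense_group`). -/

/-- The back-and-forth construction: a family of finite partial correspondences that can be
extended forth (to every element of `α`) and back (to every element of `D ⊆ β`) yields a total
correspondence which is finitely approximated by members of the family. -/
theorem exists_correspondence_of_back_and_forth {α β : Type*} [Countable α] [Countable β]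
    (P : List (α × β) → Prop) (D : Set β) (nil : P [])
    (forth : ∀ l, P l → ∀ a, ∃ b, P ((a, b) :: l))
    (back : ∀ l, P l → ∀ b ∈ D, ∃ a, P ((a, b) :: l)) :
    ∃ ρ : α → β → Prop, (∀ a, ∃ b, ρ a b) ∧ (∀ b ∈ D, ∃ a, ρ a b) ∧
      ∀ p q r : α × β, ρ p.1 p.2 → ρ q.1 q.2 → ρ r.1 r.2 →
        ∃ l, P l ∧ p ∈ l ∧ q ∈ l ∧ r ∈ l := by
  classical
  obtain ⟨e, he⟩ : ∃ e : ℕ → Option (α ⊕ β), Function.Surjective e :=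
    exists_surjective_nat _
  have step : ∀ (t : Option (α ⊕ β)) (l : {l // P l}), ∃ l' : {l // P l}, l.1 ⊆ l'.1 ∧
      (∀ a, t = some (Sum.inl a) → ∃ b, (a, b) ∈ l'.1) ∧
      (∀ b ∈ D, t = some (Sum.inr b) → ∃ a, (a, b) ∈ l'.1) := by
    rintro (_ | a | b) ⟨l, hl⟩
    · exact ⟨⟨l, hl⟩, by simp⟩
    · obtain ⟨b, hb⟩ := forth l hl a
      exact ⟨⟨_, hb⟩, List.subset_cons_self _ _, by rintro _ ⟨⟩; exact ⟨b, by simp⟩, by simp⟩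
    · by_cases h : b ∈ D
      · obtain ⟨a, ha⟩ := back l hl b h
        exact ⟨⟨_, ha⟩, List.subset_cons_self _ _, by simp, by rintro _ _ ⟨⟩; exact ⟨a, by simp⟩⟩
      · refine ⟨⟨l, hl⟩, by simp, by simp, ?_⟩
        rintro b' hb' ⟨⟩
        exact absurd hb' h
  choose next hsub hA hB using step
  let s : ℕ → {l // P l} := fun n => Nat.rec ⟨[], nil⟩ (fun n l => next (e n) l) n
  have mono : Monotone fun n => {p | p ∈ (s n).1} :=
    monotone_nat_of_le_succ fun n p hp => hsub (e n) (s n) hp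
  refine ⟨fun a b => ∃ n, (a, b) ∈ (s n).1, fun a => ?_, fun b hb => ?_, ?_⟩
  · obtain ⟨n, hn⟩ := he (some (Sum.inl a))
    obtain ⟨b, hb⟩ := hA (e n) (s n) a hn
    exact ⟨b, n + 1, hb⟩
  · obtain ⟨n, hn⟩ := he (some (Sum.inr b))
    obtain ⟨a, ha⟩ := hB (e n) (s n) b hb hn
    exact ⟨a, n + 1, ha⟩
  · rintro p q r ⟨i, hi⟩ ⟨j, hj⟩ ⟨k, hk⟩
    exact ⟨_, (s (i + j + k)).2, mono (by omega : i ≤ i + j + k) hi,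
      mono (by omega : j ≤ i + j + k) hj, mono (by omega : k ≤ i + j + k) hk⟩

/-! ### A left-orderable group which is dense in the symmetric group -/

/-- There is a countable dense linear order without endpoints, coloured by the natural numbers in
such a way that every colour is dense. -/
theorem exists_coloured_order : ∃ (Λ : Type) (_ : LinearOrder Λ) (c : Λ → ℕ),
    Countable Λ ∧ Nonempty Λ ∧ (∀ x : Λ, ∃ y, x < y) ∧ (∀ x : Λ, ∃ y, y < x) ∧
      ∀ x y : Λ, x < y → ∀ i, ∃ z, x < z ∧ z < y ∧ c z = i := by
  -- The order consists of the reals `a + i√2` with `a` rational, coloured by `i`; irrationality of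
  -- `√2` makes the colour well defined.
  let f : ℚ × ℕ → ℝ := fun p => p.1 + p.2 * √2
  have hf : ∀ p q, f p = f q → p.2 = q.2 := by
    rintro ⟨a, i⟩ ⟨b, j⟩ h
    by_contra hij
    simp only [f] at h hij
    have hne : ((i : ℚ) - j) ≠ 0 := by
      rw [sub_ne_zero]; exact_mod_cast hij
    refine irrational_sqrt_two ⟨(b - a) / (i - j), ?_⟩
    have hne' : ((i : ℝ) - j) ≠ 0 := by exact_mod_cast hne
    push_cast
    rw [div_eq_iff hne']
    linarith
  have key : ∀ x y : ℝ, x < y → ∀ i : ℕ, ∃ a : ℚ, x < f (a, i) ∧ f (a, i) < y := by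
    intro x y h i
    obtain ⟨a, h1, h2⟩ := exists_rat_btwn (sub_lt_sub_right h (i * √2))
    exact ⟨a, by simp only [f]; linarith, by simp only [f]; linarith⟩
  refine ⟨Set.range f, inferInstance, fun x => x.2.choose.2, (Set.countable_range f).to_subtype,
    ⟨⟨_, (0, 0), rfl⟩⟩, fun x => ?_, fun x => ?_, fun x y h i => ?_⟩
  · obtain ⟨a, h1, -⟩ := key x (x + 1) (by linarith) 0
    exact ⟨⟨_, (a, 0), rfl⟩, h1⟩
  · obtain ⟨a, -, h1⟩ := key (x - 1) x (by linarith) 0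
    exact ⟨⟨_, (a, 0), rfl⟩, h1⟩
  · obtain ⟨a, h1, h2⟩ := key x y h i
    refine ⟨⟨_, (a, i), rfl⟩, h1, h2, ?_⟩
    have : ∃ p, f p = f (a, i) := ⟨(a, i), rfl⟩
    exact hf _ _ this.choose_spec

section Shuffle

variable {Λ : Type*} [LinearOrder Λ] [Nonempty Λ] {c : Λ → ℕ}

/-- Density first yields two points `m < m'` in the gap; a point of the required colour then lies
between them. -/
theorem exists_coloured_between (hup : ∀ x : Λ, ∃ y, x < y) (hdown : ∀ x : Λ, ∃ y, y < x)
    (hc : ∀ x y : Λ, x < y → ∀ i, ∃ z, x < z ∧ z < y ∧ c z = i)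
    (lo hi : Finset Λ) (h : ∀ x ∈ lo, ∀ y ∈ hi, x < y) (i : ℕ) :
    ∃ z, (∀ x ∈ lo, x < z) ∧ (∀ y ∈ hi, z < y) ∧ c z = i := by
  classical
  have : NoMaxOrder Λ := ⟨hup⟩
  have : NoMinOrder Λ := ⟨hdown⟩
  have : DenselyOrdered Λ :=
    ⟨fun x y h => let ⟨z, h1, h2, _⟩ := hc x y h 0; ⟨z, h1, h2⟩⟩
  obtain ⟨m, hm1, hm2⟩ := Order.exists_between_finsets lo hi h
  obtain ⟨m', hm1', hm2'⟩ := Order.exists_between_finsets (insert m lo) hi (by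
    intro x hx y hy
    rcases Finset.mem_insert.1 hx with rfl | hx
    exacts [hm2 y hy, h x hx y hy])
  obtain ⟨z, h1, h2, h3⟩ := hc m m' (hm1' m (by simp)) i
  exact ⟨z, fun x hx => (hm1 x hx).trans h1, fun y hy => h2.trans (hm2' y hy), h3⟩

/-- Every permutation of the colours is induced by an order automorphism. -/
theorem exists_orderIso_colour [Countable Λ] (hup : ∀ x : Λ, ∃ y, x < y)
    (hdown : ∀ x : Λ, ∃ y, y < x)
    (hc : ∀ x y : Λ, x < y → ∀ i, ∃ z, x < z ∧ z < y ∧ c z = i) (π : Equiv.Perm ℕ) :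
    ∃ p : Λ ≃o Λ, ∀ x, c (p x) = π (c x) := by
  classical
  -- Quantified over `π`, so that the back step is the forth step for `π.symm` applied to the
  -- swapped list.
  have ext : ∀ (π : Equiv.Perm ℕ) (l : List (Λ × Λ)),
      (∀ p ∈ l, c p.2 = π (c p.1) ∧ ∀ q ∈ l, p.1 < q.1 ↔ p.2 < q.2) → ∀ a, ∃ b,
      ∀ p ∈ (a, b) :: l, c p.2 = π (c p.1) ∧ ∀ q ∈ (a, b) :: l, p.1 < q.1 ↔ p.2 < q.2 := by
    intro π l hl a
    suffices ∃ b, c b = π (c a) ∧ ∀ p ∈ l, (p.1 < a ↔ p.2 < b) ∧ (a < p.1 ↔ b < p.2) by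
      obtain ⟨b, hb, h⟩ := this
      refine ⟨b, fun p hp => ?_⟩
      rcases List.mem_cons.1 hp with rfl | hp
      · refine ⟨hb, fun q hq => ?_⟩
        rcases List.mem_cons.1 hq with rfl | hq
        exacts [by simp, (h q hq).2]
      · refine ⟨(hl p hp).1, fun q hq => ?_⟩
        rcases List.mem_cons.1 hq with rfl | hq
        exacts [(h p hp).1, (hl p hp).2 q hq]
    by_cases h : ∃ b, (a, b) ∈ l
    · obtain ⟨b, hb⟩ := h
      exact ⟨b, (hl _ hb).1, fun p hp => ⟨(hl p hp).2 _ hb, (hl _ hb).2 p hp⟩⟩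
    · obtain ⟨b, h1, h2, h3⟩ := exists_coloured_between hup hdown hc
        ((l.toFinset.filter fun p => p.1 < a).image Prod.snd)
        ((l.toFinset.filter fun p => a < p.1).image Prod.snd) (by
          simp only [Finset.mem_image, Finset.mem_filter, List.mem_toFinset]
          rintro _ ⟨p, ⟨hp, hpa⟩, rfl⟩ _ ⟨q, ⟨hq, hqa⟩, rfl⟩
          exact ((hl p hp).2 q hq).1 (hpa.trans hqa)) (π (c a))
      simp only [Finset.mem_image, Finset.mem_filter, List.mem_toFinset] at h1 h2
      refine ⟨b, h3, fun p hp => ?_⟩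
      rcases lt_trichotomy p.1 a with hlt | heq | hgt
      · have := h1 p.2 ⟨p, ⟨hp, hlt⟩, rfl⟩
        exact ⟨iff_of_true hlt this, iff_of_false hlt.not_gt this.not_gt⟩
      · exact absurd ⟨p.2, heq ▸ hp⟩ h
      · have := h2 p.2 ⟨p, ⟨hp, hgt⟩, rfl⟩
        exact ⟨iff_of_false hgt.not_gt this.not_gt, iff_of_true hgt this⟩
  obtain ⟨ρ, hρ1, hρ2, hρ3⟩ := exists_correspondence_of_back_and_forth
    (fun l : List (Λ × Λ) => ∀ p ∈ l, c p.2 = π (c p.1) ∧ ∀ q ∈ l, p.1 < q.1 ↔ p.2 < q.2)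
    Set.univ (by simp) (fun l hl a => ext π l hl a) (fun l hl b _ => by
      obtain ⟨a, ha⟩ := ext π.symm (l.map Prod.swap) (by
        simp only [List.mem_map]
        rintro _ ⟨p, hp, rfl⟩
        refine ⟨by simp [(hl p hp).1], ?_⟩
        rintro _ ⟨q, hq, rfl⟩
        exact ((hl p hp).2 q hq).symm) b
      refine ⟨a, fun p hp => ?_⟩
      have mem : ∀ q ∈ (a, b) :: l, q.swap ∈ (b, a) :: l.map Prod.swap := by
        intro q hq
        rcases List.mem_cons.1 hq with rfl | hq
        · simp
        · exact List.mem_cons_of_mem _ (List.mem_map_of_mem hq)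
      have := ha p.swap (mem p hp)
      refine ⟨?_, fun q hq => (this.2 q.swap (mem q hq)).symm⟩
      have h1 := this.1
      simp only [Prod.snd_swap, Prod.fst_swap] at h1
      rw [h1, Equiv.apply_symm_apply])
  have lt_iff : ∀ a b a' b', ρ a b → ρ a' b' → (a < a' ↔ b < b') := by
    intro a b a' b' h h'
    obtain ⟨l, hl, h1, h2, -⟩ := hρ3 (a, b) (a', b') (a, b) h h' h
    exact (hl _ h1).2 _ h2
  choose f hf using hρ1
  have hmono : StrictMono f := fun a a' h => (lt_iff _ _ _ _ (hf a) (hf a')).1 h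
  have hsurj : Function.Surjective f := by
    intro b
    obtain ⟨a, ha⟩ := hρ2 b trivial
    refine ⟨a, le_antisymm ?_ ?_⟩
    · exact not_lt.1 fun h => lt_irrefl a ((lt_iff _ _ _ _ ha (hf a)).2 h)
    · exact not_lt.1 fun h => lt_irrefl a ((lt_iff _ _ _ _ (hf a) ha).2 h)
  refine ⟨StrictMono.orderIsoOfSurjective f hmono hsurj, fun x => ?_⟩
  obtain ⟨l, hl, h1, -⟩ := hρ3 (x, f x) (x, f x) (x, f x) (hf x) (hf x) (hf x)
  exact (hl _ h1).1

end Shuffle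

/-- The automorphism group of a countable linear order is left-orderable, so it has the
two-unique-products property. -/
theorem twoUniqueProds_orderIso (Λ : Type*) [LinearOrder Λ] [Countable Λ] [Nonempty Λ] :
    TwoUniqueProds (Λ ≃o Λ) := by
  obtain ⟨e, he⟩ := exists_surjective_nat Λ
  -- Automorphisms are compared at the first point of an enumeration where they differ. Composing on
  -- the left with an automorphism keeps that point and the direction of the inequality.
  let F : (Λ ≃o Λ) → Lex (ℕ → Λ) := fun p => toLex fun n => p (e n)
  have hF : Function.Injective F := by
    intro p q h
    ext x
    obtain ⟨n, rfl⟩ := he x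
    exact congrFun (toLex_inj.1 h) n
  let : LinearOrder (Λ ≃o Λ) := LinearOrder.lift' F hF
  have : MulLeftStrictMono (Λ ≃o Λ) := ⟨fun r p q h => by
    obtain ⟨n, h1, h2⟩ : F p < F q := h
    exact ⟨n, fun j hj => congrArg r (h1 j hj), r.strictMono h2⟩⟩
  infer_instance

/-- There is a countable group with the two-unique-products property which maps onto a dense
subgroup of the group of all permutations of the natural numbers. -/
theorem exists_dense_group : ∃ (H : Type) (_ : Group H) (θ : H →* Equiv.Perm ℕ),
    Countable H ∧ TwoUniqueProds H ∧
      ∀ (σ : Equiv.Perm ℕ) (n : ℕ), ∃ h, ∀ i < n, θ h i = σ i := by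
  classical
  obtain ⟨Λ, _, c, _, _, hup, hdown, hc⟩ := exists_coloured_order
  have hcs : Function.Surjective c := fun i => by
    obtain ⟨x⟩ := ‹Nonempty Λ›
    obtain ⟨y, hy⟩ := hup x
    obtain ⟨z, -, -, hz⟩ := hc x y hy i
    exact ⟨z, hz⟩
  -- Pairs of an automorphism and the colour permutation it induces. Every colour occurs, so the
  -- first component determines the second and `G` inherits two unique products.
  let G : Subgroup ((Λ ≃o Λ) × Equiv.Perm ℕ) :=
    { carrier := {p | ∀ x, c (p.1 x) = p.2 (c x)}
      mul_mem' := fun {p q} hp hq x => by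
        change c (p.1 (q.1 x)) = p.2 (q.2 (c x))
        rw [hp (q.1 x), hq x]
      one_mem' := fun x => rfl
      inv_mem' := fun {p} hp x => by
        have := hp (p.1⁻¹ x)
        rw [RelIso.apply_inv_self] at this
        rw [Prod.fst_inv, Prod.snd_inv, this]
        exact (Equiv.symm_apply_apply p.2 _).symm }
  have hG : TwoUniqueProds G := by
    refine TwoUniqueProds.of_injective_mulHom
      ((MonoidHom.fst (Λ ≃o Λ) (Equiv.Perm ℕ)).comp G.subtype).toMulHom ?_
      (twoUniqueProds_orderIso Λ)
    rintro ⟨⟨p, π⟩, hp⟩ ⟨⟨q, τ⟩, hq⟩ h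
    obtain rfl : p = q := h
    have : π = τ := by
      ext i
      obtain ⟨x, rfl⟩ := hcs i
      exact (hp x).symm.trans (hq x)
    simp [this]
  -- One lift for each finite partial permutation suffices for density and gives only countably many
  -- generators.
  have ex : ∀ l : List ℕ, ∃ g : G, (∃ σ : Equiv.Perm ℕ, ∀ i (h : i < l.length), σ i = l[i]) →
      ∀ i (h : i < l.length), g.1.2 i = l[i] := by
    intro l
    by_cases h : ∃ σ : Equiv.Perm ℕ, ∀ i (h : i < l.length), σ i = l[i]
    · obtain ⟨σ, hσ⟩ := h
      obtain ⟨p, hp⟩ := exists_orderIso_colour hup hdown hc σ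
      exact ⟨⟨(p, σ), hp⟩, fun _ => hσ⟩
    · exact ⟨1, fun h' => absurd h' h⟩
  choose g hg using ex
  let φ : FreeGroup (List ℕ) →* G := FreeGroup.lift g
  refine ⟨φ.range, inferInstance,
    (MonoidHom.snd (Λ ≃o Λ) (Equiv.Perm ℕ)).comp (G.subtype.comp φ.range.subtype), ?_, ?_, ?_⟩
  · have : Countable (FreeGroup (List ℕ)) := Quot.mk_surjective.countable
    exact (Set.countable_range φ).to_subtype
  · exact TwoUniqueProds.of_injective_mulHom φ.range.subtype.toMulHom Subtype.val_injective hG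
  · intro σ n
    refine ⟨⟨φ (FreeGroup.of (List.ofFn fun i : Fin n => σ i)), _, rfl⟩, fun i hi => ?_⟩
    have := hg (List.ofFn fun i : Fin n => σ i) ⟨σ, by simp⟩ i (by simpa using hi)
    simpa [φ] using this

/-! ### Isomorphism with a fixed countable structure is a Borel condition -/

/-- Infinitary formulas in a language of ternary relation symbols; variables are de Bruijn
indices. -/
inductive InfForm (ι : Type u) : Type u
  | top : InfForm ι
  | atom (i : ι) (j k l : ℕ) : InfForm ι
  | not (φ : InfForm ι) : InfForm ι
  | and (φ : ℕ → InfForm ι) : InfForm ι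
  | ex (φ : InfForm ι) : InfForm ι

/-- Truth of an infinitary formula in the structure `(dom, q)`. -/
def InfForm.Realize {ι : Type u} {M : Type v} (dom : M → Prop) (q : ι → M → M → M → Prop) :
    InfForm ι → List M → Prop
  | top, _ => True
  | atom i j k l, s => ∃ x y z, s[j]? = some x ∧ s[k]? = some y ∧ s[l]? = some z ∧ q i x y z
  | not φ, s => ¬ φ.Realize dom q s
  | and φ, s => ∀ n, (φ n).Realize dom q s
  | ex φ, s => ∃ m, dom m ∧ φ.Realize dom q (m :: s)

/-- `ρ` is an isomorphism, presented as a relation, from the structure `(A, Q)` to the structure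
`(dom, q)` in which some `q i` may be interpreted as a congruence. -/
structure IsPresentation {ι : Type u} {A : Type v} {M : Type w} (Q : ι → A → A → A → Prop)
    (dom : M → Prop) (q : ι → M → M → M → Prop) (ρ : A → M → Prop) : Prop where
  total : ∀ a, ∃ b, ρ a b
  mem : ∀ a b, ρ a b → dom b
  onto : ∀ b, dom b → ∃ a, ρ a b
  rel_iff : ∀ i a b a' b' a'' b'', ρ a b → ρ a' b' → ρ a'' b'' → (q i b b' b'' ↔ Q i a a' a'')

section Scott

variable {ι : Type u} {A : Type v} {M : Type w} {Q : ι → A → A → A → Prop} {dom : M → Prop}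
  {q : ι → M → M → M → Prop} {ρ : A → M → Prop}

theorem forall₂_getElem?_some {s : List A} {t : List M} (h : List.Forall₂ ρ s t) (j : ℕ) {x : A}
    (hx : s[j]? = some x) : ∃ y, t[j]? = some y ∧ ρ x y := by
  induction h generalizing j with
  | nil => simp at hx
  | cons h _ ih =>
    cases j with
    | zero => simp at hx; subst hx; exact ⟨_, rfl, h⟩
    | succ j => simpa using ih j (by simpa using hx)

theorem forall₂_getElem?_some' {s : List A} {t : List M} (h : List.Forall₂ ρ s t) (j : ℕ) {y : M}
    (hy : t[j]? = some y) : ∃ x, s[j]? = some x ∧ ρ x y := by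
  induction h generalizing j with
  | nil => simp at hy
  | cons h _ ih =>
    cases j with
    | zero => simp at hy; subst hy; exact ⟨_, rfl, h⟩
    | succ j => simpa using ih j (by simpa using hy)

/-- Formulas have no built-in equality, so an isomorphism onto a structure modulo a congruence
preserves truth, even though `ρ` need not be a function. -/
theorem IsPresentation.realize_iff (h : IsPresentation Q dom q ρ) (φ : InfForm ι) {s : List A}
    {t : List M} (hst : List.Forall₂ ρ s t) :
    φ.Realize dom q t ↔ φ.Realize (fun _ => True) Q s := by
  induction φ generalizing s t with
  | top => rfl
  | atom i j k l =>
    constructor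
    · rintro ⟨x, y, z, hx, hy, hz, hq⟩
      obtain ⟨x', hx', hx⟩ := forall₂_getElem?_some' hst _ hx
      obtain ⟨y', hy', hy⟩ := forall₂_getElem?_some' hst _ hy
      obtain ⟨z', hz', hz⟩ := forall₂_getElem?_some' hst _ hz
      exact ⟨x', y', z', hx', hy', hz', (h.rel_iff i _ _ _ _ _ _ hx hy hz).1 hq⟩
    · rintro ⟨x, y, z, hx, hy, hz, hq⟩
      obtain ⟨x', hx', hx⟩ := forall₂_getElem?_some hst _ hx
      obtain ⟨y', hy', hy⟩ := forall₂_getElem?_some hst _ hy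
      obtain ⟨z', hz', hz⟩ := forall₂_getElem?_some hst _ hz
      exact ⟨x', y', z', hx', hy', hz', (h.rel_iff i _ _ _ _ _ _ hx hy hz).2 hq⟩
  | not φ ih => exact not_congr (ih hst)
  | and φ ih => exact forall_congr' fun n => ih n hst
  | ex φ ih =>
    constructor
    · rintro ⟨b, hb, hφ⟩
      obtain ⟨a, ha⟩ := h.onto b hb
      exact ⟨a, trivial, (ih (List.Forall₂.cons ha hst)).1 hφ⟩
    · rintro ⟨a, -, hφ⟩
      obtain ⟨b, hb⟩ := h.total a
      exact ⟨b, h.mem _ _ hb, (ih (List.Forall₂.cons hb hst)).2 hφ⟩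

/-- Two tuples of `A` satisfy the same infinitary formulas. -/
def InfEquiv (Q : ι → A → A → A → Prop) (s t : List A) : Prop :=
  ∀ φ : InfForm ι, φ.Realize (fun _ => True) Q s ↔ φ.Realize (fun _ => True) Q t

theorem exists_separating_form {s t : List A} (h : ¬ InfEquiv Q s t) : ∃ φ : InfForm ι,
    φ.Realize (fun _ => True) Q s ∧ ¬ φ.Realize (fun _ => True) Q t := by
  obtain ⟨φ, hφ⟩ := not_forall.1 h
  by_cases hs : φ.Realize (fun _ => True) Q s
  · exact ⟨φ, hs, fun ht => hφ (iff_of_true hs ht)⟩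
  · exact ⟨φ.not, hs, fun ht => hφ (iff_of_false hs ht)⟩

/-- If every `b` failed, conjoin the formulas separating `a :: s` from each `b :: t`. The
existential closure holds at `s`, hence at `t`, and its witness there violates its own conjunct. -/
theorem InfEquiv.exists_cons [Countable A] {s t : List A} (h : InfEquiv Q s t) (a : A) :
    ∃ b, InfEquiv Q (a :: s) (b :: t) := by
  by_contra! hne
  choose φ hφ using fun b => exists_separating_form (hne b)
  have : Nonempty A := ⟨a⟩
  obtain ⟨e, he⟩ := exists_surjective_nat A
  obtain ⟨b, -, hb⟩ := (h (.ex (.and fun n => φ (e n)))).1 ⟨a, trivial, fun n => (hφ _).1⟩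
  obtain ⟨n, rfl⟩ := he b
  exact (hφ _).2 (hb n)

/-- There are only countably many tuples, so one separating formula for each inequivalent tuple can
be conjoined. This replaces an induction on Scott rank. -/
theorem exists_isolating_form [Countable A] (Q : ι → A → A → A → Prop) (s : List A) :
    ∃ φ : InfForm ι, ∀ t, φ.Realize (fun _ => True) Q t ↔ InfEquiv Q s t := by
  have : ∀ t, ∃ φ : InfForm ι, φ.Realize (fun _ => True) Q s ∧
      (φ.Realize (fun _ => True) Q t → InfEquiv Q s t) := by
    intro t
    by_cases h : InfEquiv Q s t
    · exact ⟨.top, trivial, fun _ => h⟩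
    · obtain ⟨φ, h1, h2⟩ := exists_separating_form h
      exact ⟨φ, h1, fun h => absurd h h2⟩
  choose φ hφ using this
  obtain ⟨e, he⟩ := exists_surjective_nat (List A)
  refine ⟨.and fun n => φ (e n), fun t => ⟨fun h => ?_, fun h => ?_⟩⟩
  · obtain ⟨n, rfl⟩ := he t
    exact (hφ _).2 (h n)
  · exact (h _).1 fun n => (hφ _).1

theorem measurableSet_realize {𝒳 : Type*} [MeasurableSpace 𝒳] [Countable M] {dom : 𝒳 → M → Prop}
    {q : 𝒳 → ι → M → M → M → Prop} (hdom : ∀ b, MeasurableSet {x | dom x b})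
    (hq : ∀ i b b' b'', MeasurableSet {x | q x i b b' b''}) (φ : InfForm ι) (t : List M) :
    MeasurableSet {x | φ.Realize (dom x) (q x) t} := by
  induction φ generalizing t with
  | top => exact MeasurableSet.const True
  | atom i j k l =>
    simp only [InfForm.Realize, measurableSet_setOfPred] at hq ⊢
    exact .exists fun b => .exists fun b' => .exists fun b'' =>
      measurable_const.and (measurable_const.and (measurable_const.and (hq i b b' b'')))
  | not φ ih => exact (ih t).compl
  | and φ ih =>
    simp only [InfForm.Realize, measurableSet_setOfPred] at ih ⊢
    exact .forall fun n => ih n t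
  | ex φ ih =>
    simp only [InfForm.Realize, measurableSet_setOfPred] at ih hdom ⊢
    exact .exists fun b => (hdom b).and (ih (b :: t))

/-- The set of (presentations of) structures that are isomorphic to a fixed countable structure
is measurable. -/
theorem measurableSet_isPresentation {𝒳 : Type*} [MeasurableSpace 𝒳] [Countable M] [Countable A]
    [Countable ι] (Q : ι → A → A → A → Prop) {dom : 𝒳 → M → Prop}
    {q : 𝒳 → ι → M → M → M → Prop} (hdom : ∀ b, MeasurableSet {x | dom x b})
    (hq : ∀ i b b' b'', MeasurableSet {x | q x i b b' b''}) :
    MeasurableSet {x | ∃ ρ, IsPresentation Q (dom x) (q x) ρ} := by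
  choose θ hθ using exists_isolating_form Q
  -- The Scott sentence: the empty tuple has the right type, and any tuple satisfying the type of a
  -- tuple of `A` can be extended forth and back and has the same atomic facts.
  have eq : {x | ∃ ρ, IsPresentation Q (dom x) (q x) ρ} =
      {x | (θ []).Realize (dom x) (q x) []} ∩ ⋂ l : List (A × M),
        ({x | ∀ p ∈ l, dom x p.2} ∩
            {x | (θ (l.map Prod.fst)).Realize (dom x) (q x) (l.map Prod.snd)})ᶜ ∪
          ((⋂ a, ⋃ b, ({x | dom x b} ∩
              {x | (θ (a :: l.map Prod.fst)).Realize (dom x) (q x) (b :: l.map Prod.snd)})) ∩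
            (⋂ b, {x | dom x b}ᶜ ∪
              ⋃ a, {x | (θ (a :: l.map Prod.fst)).Realize (dom x) (q x)
                (b :: l.map Prod.snd)}) ∩
            ⋂ i, ⋂ j, ⋂ k, ⋂ n, {x | (InfForm.atom i j k n).Realize (dom x) (q x)
              (l.map Prod.snd) ↔ (InfForm.atom i j k n).Realize (fun _ => True) Q
              (l.map Prod.fst)}) := by
    ext x
    simp only [Set.mem_inter_iff, Set.mem_iInter, Set.mem_union, Set.mem_compl_iff,
      Set.mem_iUnion, Set.mem_ofPred_eq, ← imp_iff_not_or]
    constructor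
    · rintro ⟨ρ, hρ⟩
      refine ⟨(hρ.realize_iff _ .nil).2 ((hθ _ _).2 fun _ => Iff.rfl), ?_⟩
      rintro l ⟨hl, hθl⟩
      -- Pull the tuple back along the isomorphism: `s` need not be the given tuple of `A`, but it
      -- has the same infinitary type.
      have : ∃ s, List.Forall₂ ρ s (l.map Prod.snd) := by
        clear hθl
        induction l with
        | nil => exact ⟨[], .nil⟩
        | cons p l ih =>
          obtain ⟨s, hs⟩ := ih fun p hp => hl p (by simp [hp])
          obtain ⟨a, ha⟩ := hρ.onto p.2 (hl p (by simp))
          exact ⟨a :: s, .cons ha hs⟩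
      obtain ⟨s, hs⟩ := this
      have hs' : InfEquiv Q (l.map Prod.fst) s := (hθ _ _).1 ((hρ.realize_iff _ hs).1 hθl)
      refine ⟨⟨fun a => ?_, fun b hb => ?_⟩, fun i j k n => ?_⟩
      · obtain ⟨a', ha'⟩ := hs'.exists_cons a
        obtain ⟨b, hb⟩ := hρ.total a'
        exact ⟨b, hρ.mem _ _ hb, (hρ.realize_iff _ (.cons hb hs)).2 ((hθ _ _).2 ha')⟩
      · obtain ⟨a', ha'⟩ := hρ.onto b hb
        have hs'' : InfEquiv Q s (l.map Prod.fst) := fun φ => (hs' φ).symm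
        obtain ⟨a, ha⟩ := hs''.exists_cons a'
        exact ⟨a, (hρ.realize_iff _ (.cons ha' hs)).2 ((hθ _ _).2 fun φ => (ha φ).symm)⟩
      · exact (hρ.realize_iff _ hs).trans (hs' _).symm
    · rintro ⟨h0, h⟩
      obtain ⟨ρ, h1, h2, h3⟩ := exists_correspondence_of_back_and_forth
        (fun l : List (A × M) => (∀ p ∈ l, dom x p.2) ∧
          (θ (l.map Prod.fst)).Realize (dom x) (q x) (l.map Prod.snd)) {b | dom x b}
        ⟨by simp, h0⟩ (fun l hl a => by
          obtain ⟨b, hb, hb'⟩ := (h l hl).1.1 a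
          exact ⟨b, List.forall_mem_cons.2 ⟨hb, hl.1⟩, hb'⟩) (fun l hl b hb => by
          obtain ⟨a, ha⟩ := (h l hl).1.2 b hb
          exact ⟨a, List.forall_mem_cons.2 ⟨hb, hl.1⟩, ha⟩)
      refine ⟨ρ, h1, fun a b hab => ?_, h2, fun i a b a' b' a'' b'' hab hab' hab'' => ?_⟩
      · obtain ⟨l, hl, hm, -⟩ := h3 (a, b) (a, b) (a, b) hab hab hab
        exact hl.1 _ hm
      · obtain ⟨l, hl, hm, hm', hm''⟩ := h3 (a, b) (a', b') (a'', b'') hab hab' hab''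
        obtain ⟨j, hj⟩ := List.mem_iff_getElem?.1 hm
        obtain ⟨k, hk⟩ := List.mem_iff_getElem?.1 hm'
        obtain ⟨n, hn⟩ := List.mem_iff_getElem?.1 hm''
        simpa [InfForm.Realize, hj, hk, hn] using (h l hl).2 i j k n
  rw [eq]
  have hR := measurableSet_realize hdom hq
  refine (hR _ _).inter (MeasurableSet.iInter fun l => ((MeasurableSet.inter ?_ (hR _ _)).compl).union
    ((MeasurableSet.inter ?_ ?_).inter ?_))
  · have : {x | ∀ p ∈ l, dom x p.2} = ⋂ p ∈ l, {x | dom x p.2} := by ext; simp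
    rw [this]
    exact MeasurableSet.biInter (Set.to_countable _) fun p _ => hdom _
  · exact .iInter fun a => .iUnion fun b => (hdom b).inter (hR _ _)
  · exact .iInter fun b => (hdom b).compl.union (.iUnion fun a => hR _ _)
  · exact .iInter fun i => .iInter fun j => .iInter fun k => .iInter fun n =>
      (hR _ _).iff (MeasurableSet.const _)

end Scott

/-! ### Tagged modules as structures -/

section Operations

variable {R : Type u} {M : Type v} (S : (taggedLanguage R).Structure M)

/-- The interpretation of the constant symbol `0`. -/
def zeroOf : M := S.funMap (ModFunc.zero : (taggedLanguage R).Functions 0) ![]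

/-- The interpretation of the function symbol `+`. -/
def addOf (a b : M) : M := S.funMap (ModFunc.add : (taggedLanguage R).Functions 2) ![a, b]

/-- The interpretation of the scalar multiplications. -/
def smulOf (r : R) (a : M) : M :=
  S.funMap (ModFunc.smul r : (taggedLanguage R).Functions 1) ![a]

/-- The interpretation of the unary predicates. -/
def tagOf (n : ℕ) (a : M) : Prop :=
  S.RelMap (TagRel.tag n : (taggedLanguage R).Relations 1) ![a]

end Operations

theorem nonempty_equiv_iff {R : Type u} {M : Type v} {N : Type w}
    (S : (taggedLanguage R).Structure M) (T : (taggedLanguage R).Structure N) :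
    Nonempty (@FirstOrder.Language.Equiv (taggedLanguage R) M N S T) ↔
      ∃ ψ : M ≃ N, ψ (zeroOf S) = zeroOf T ∧
        (∀ a b, ψ (addOf S a b) = addOf T (ψ a) (ψ b)) ∧
        (∀ r a, ψ (smulOf S r a) = smulOf T r (ψ a)) ∧
        ∀ n a, tagOf S n a ↔ tagOf T n (ψ a) := by
  constructor
  · rintro ⟨ε⟩
    refine ⟨ε.toEquiv, ?_, fun a b => ?_, fun r a => ?_, fun n a => ?_⟩
    · refine (ε.map_fun' _ _).trans (congrArg _ ?_)
      exact Subsingleton.elim _ _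
    · refine (ε.map_fun' _ _).trans (congrArg _ ?_)
      ext i; fin_cases i <;> rfl
    · refine (ε.map_fun' _ _).trans (congrArg _ ?_)
      ext i; fin_cases i; rfl
    · refine (ε.map_rel' _ _).symm.trans (iff_of_eq (congrArg _ ?_))
      ext i; fin_cases i; rfl
  · rintro ⟨ψ, h0, hadd, hsmul, htag⟩
    refine ⟨@FirstOrder.Language.Equiv.mk (taggedLanguage R) M N S T ψ ?_ ?_⟩
    · intro n f x
      cases f with
      | zero =>
        have h1 : x = ![] := Subsingleton.elim _ _
        subst h1
        refine h0.trans (congrArg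
          (fun y => T.funMap (ModFunc.zero : (taggedLanguage R).Functions 0) y) ?_)
        exact Subsingleton.elim _ _
      | add =>
        have h1 : x = ![x 0, x 1] := by ext i; fin_cases i <;> rfl
        rw [h1]
        refine (hadd _ _).trans (congrArg
          (fun y => T.funMap (ModFunc.add : (taggedLanguage R).Functions 2) y) ?_)
        ext i; fin_cases i <;> rfl
      | smul r =>
        have h1 : x = ![x 0] := by ext i; fin_cases i; rfl
        rw [h1]
        refine (hsmul _ _).trans (congrArg
          (fun y => T.funMap (ModFunc.smul r : (taggedLanguage R).Functions 1) y) ?_)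
        ext i; fin_cases i; rfl
    · intro n s x
      cases s with
      | tag n =>
        have h1 : x = ![x 0] := by ext i; fin_cases i; rfl
        rw [h1]
        refine Iff.trans (iff_of_eq (congrArg _ ?_)) (htag n _).symm
        ext i; fin_cases i; rfl

/-! ### Presentations of modules -/

/-- Relation symbols for presentations of modules. -/
inductive ModRel (R : Type u) : Type u
  | eq | zero | add | smul (r : R)

instance {R : Type u} [Countable R] : Countable (ModRel R) := by
  let f : Option (Option (Option R)) → ModRel R := fun
    | none => .eq
    | some none => .zero
    | some (some none) => .add
    | some (some (some r)) => .smul r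
  have hf : Function.Surjective f := by
    rintro (_ | _ | _ | r)
    exacts [⟨none, rfl⟩, ⟨some none, rfl⟩, ⟨some (some none), rfl⟩, ⟨some (some (some r)), rfl⟩]
  exact hf.countable

/-- The relations of a module modulo a congruence `C`. -/
def modRel {R : Type u} {M : Type v} (C : M → M → Prop) (z : M) (add : M → M → M)
    (smul : R → M → M) : ModRel R → M → M → M → Prop
  | .eq, a, b, _ => C a b
  | .zero, a, _, _ => C a z
  | .add, a, b, c => C (add a b) c
  | .smul r, a, b, _ => C (smul r a) b

theorem exists_isPresentation_comp_iff {ι : Type u} {A : Type v} {W M : Type*}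
    {Q : ι → A → A → A → Prop} {dom : M → Prop} {q : ι → M → M → M → Prop}
    {q' : ι → W → W → W → Prop} (j : W → M) (hj : ∀ b, dom b ↔ ∃ w, j w = b)
    (hq : ∀ i x y z, q i (j x) (j y) (j z) ↔ q' i x y z) :
    (∃ ρ, IsPresentation Q dom q ρ) ↔ ∃ ρ, IsPresentation Q (fun _ => True) q' ρ := by
  constructor
  · rintro ⟨ρ, h⟩
    refine ⟨fun a w => ρ a (j w), fun a => ?_, fun _ _ _ => trivial,
      fun w _ => h.onto _ ((hj _).2 ⟨w, rfl⟩), fun i a b a' b' a'' b'' h1 h2 h3 => ?_⟩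
    · obtain ⟨b, hb⟩ := h.total a
      obtain ⟨w, rfl⟩ := (hj b).1 (h.mem _ _ hb)
      exact ⟨w, hb⟩
    · exact (hq _ _ _ _).symm.trans (h.rel_iff i _ _ _ _ _ _ h1 h2 h3)
  · rintro ⟨ρ, h⟩
    refine ⟨fun a b => ∃ w, j w = b ∧ ρ a w, fun a => ?_, ?_, fun b hb => ?_, ?_⟩
    · obtain ⟨w, hw⟩ := h.total a
      exact ⟨_, w, rfl, hw⟩
    · rintro a _ ⟨w, rfl, -⟩
      exact (hj _).2 ⟨w, rfl⟩
    · obtain ⟨w, rfl⟩ := (hj b).1 hb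
      obtain ⟨a, ha⟩ := h.onto w trivial
      exact ⟨a, w, rfl, ha⟩
    · rintro i a _ a' _ a'' _ ⟨w, rfl, h1⟩ ⟨w', rfl, h2⟩ ⟨w'', rfl, h3⟩
      exact (hq _ _ _ _).trans (h.rel_iff i _ _ _ _ _ _ h1 h2 h3)

section Module

variable {R : Type u} [Ring R] {W : Type v} [AddCommGroup W] [Module R W]
  {F : Type w} [AddCommGroup F] [Module R F]

/-- The relations of an `R`-module. -/
abbrev moduleRel (R : Type u) [Ring R] (F : Type w) [AddCommGroup F] [Module R F] :
    ModRel R → F → F → F → Prop :=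
  modRel (fun a b => a = b) 0 (fun a b => a + b) (fun r a => r • a)

/-- Choosing a preimage of each `w` gives a linear map: `.zero` identifies its kernel with `N`, and
`.eq` yields surjectivity. -/
theorem exists_isPresentation_quotient_iff (N : Submodule R W) :
    (∃ ρ, IsPresentation (moduleRel R F) (fun _ => True)
      (modRel (fun a b => a - b ∈ N) 0 (fun a b => a + b) (fun r a => r • a)) ρ) ↔
    Nonempty ((W ⧸ N) ≃ₗ[R] F) := by
  constructor
  · rintro ⟨ρ, h⟩
    choose f hf using fun w => h.onto w trivial
    have hadd : ∀ a b, f (a + b) = f a + f b := fun a b =>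
      ((h.rel_iff .add _ _ _ _ _ _ (hf a) (hf b) (hf (a + b))).1 (by simp [modRel])).symm
    have hsmul : ∀ (r : R) a, f (r • a) = r • f a := fun r a =>
      ((h.rel_iff (.smul r) _ _ _ _ _ _ (hf a) (hf (r • a)) (hf a)).1 (by simp [modRel])).symm
    let g : W →ₗ[R] F := { toFun := f, map_add' := hadd, map_smul' := hsmul }
    have hker : LinearMap.ker g = N := by
      ext a
      have := h.rel_iff .zero _ _ _ _ _ _ (hf a) (hf a) (hf a)
      simpa [modRel, g] using this.symm
    have hsurj : Function.Surjective g := fun x => by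
      obtain ⟨w, hw⟩ := h.total x
      exact ⟨w, (h.rel_iff .eq _ _ _ _ _ _ (hf w) hw hw).1 (by simp [modRel])⟩
    exact ⟨(Submodule.quotEquivOfEq _ _ hker.symm).trans (g.quotKerEquivOfSurjective hsurj)⟩
  · rintro ⟨e⟩
    have eq_iff : ∀ w w' : W, e (N.mkQ w) = e (N.mkQ w') ↔ w - w' ∈ N := fun w w' => by
      rw [e.injective.eq_iff]
      exact Submodule.Quotient.eq N
    refine ⟨fun a w => e (N.mkQ w) = a, fun a => ?_, fun _ _ _ => trivial,
      fun w _ => ⟨_, rfl⟩, ?_⟩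
    · obtain ⟨w, hw⟩ := N.mkQ_surjective (e.symm a)
      exact ⟨w, by rw [hw, e.apply_symm_apply]⟩
    · rintro (_ | _ | _ | r) _ w _ w' _ w'' rfl rfl rfl <;>
      · simp only [modRel, ← eq_iff]
        try simp

theorem exists_isPresentation_iff :
    (∃ ρ, IsPresentation (moduleRel R F) (fun _ => True) (moduleRel R W) ρ) ↔
    Nonempty (W ≃ₗ[R] F) := by
  have := exists_isPresentation_quotient_iff (F := F) (⊥ : Submodule R W)
  simp only [Submodule.mem_bot, sub_eq_zero] at this
  rw [moduleRel, moduleRel, this]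
  exact ⟨fun ⟨e⟩ => ⟨(Submodule.quotEquivOfEqBot _ rfl).symm.trans e⟩,
    fun ⟨e⟩ => ⟨(Submodule.quotEquivOfEqBot _ rfl).trans e⟩⟩

end Module

/-! ### The class of free-like tagged modules is a Borel class -/

section BorelClass

variable {R : Type u} [Ring R]

/-- The relations of a tagged structure modulo a congruence `C`. -/
abbrev relOf {M : Type v} (S : (taggedLanguage R).Structure M) (C : M → M → Prop) :
    ModRel R → M → M → M → Prop :=
  modRel C (zeroOf S) (addOf S) (smulOf S)

/-- Congruence modulo the `n`-th tag. -/
def tagCongr {M : Type v} (S : (taggedLanguage R).Structure M) (n : ℕ) (a b : M) : Prop :=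
  ∃ d, tagOf S n d ∧ a = addOf S b d

/-- The intrinsic description of free-like tagged modules. -/
def IsFreeLikeStr (S : Str (taggedLanguage R)) : Prop :=
  (∃ ρ, IsPresentation (moduleRel R (ℕ →₀ R)) (fun _ => True) (relOf S (fun a b => a = b)) ρ) ∧
  ∀ n, (tagOf S n (zeroOf S) ∧ (∀ a b, tagOf S n a → tagOf S n b → tagOf S n (addOf S a b)) ∧
    ∀ r a, tagOf S n a → tagOf S n (smulOf S r a)) ∧
    (∃ ρ, IsPresentation (moduleRel R (ℕ →₀ R)) (tagOf S n) (relOf S (fun a b => a = b)) ρ) ∧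
    (∃ ρ, IsPresentation (moduleRel R (ℕ →₀ R)) (fun _ => True) (relOf S (tagCongr S n)) ρ)

section Transfer

variable {V : Type v} [AddCommGroup V] [Module R V] (M : ℕ → Submodule R V)
  (S : Str (taggedLanguage R)) (ψ : V ≃ ℕ)

theorem isFreeLikeStr_iff_of_equiv (h0 : ψ 0 = zeroOf S)
    (hadd : ∀ a b, ψ (a + b) = addOf S (ψ a) (ψ b)) (hsmul : ∀ (r : R) a, ψ (r • a) = smulOf S r (ψ a))
    (htag : ∀ n a, a ∈ M n ↔ tagOf S n (ψ a)) : IsFreeLikeStr S ↔ IsFreeLike M := by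
  have e1 : (∃ ρ, IsPresentation (moduleRel R (ℕ →₀ R)) (fun _ => True)
      (relOf S (fun a b => a = b)) ρ) ↔ Nonempty (V ≃ₗ[R] (ℕ →₀ R)) := by
    rw [← exists_isPresentation_iff]
    refine exists_isPresentation_comp_iff ψ (fun b => ⟨fun _ => ψ.surjective b, fun _ => trivial⟩) ?_
    rintro (_ | _ | _ | r) x y z <;> simp [modRel, ← h0, ← hadd, ← hsmul]
  have e2 : ∀ n, (∃ ρ, IsPresentation (moduleRel R (ℕ →₀ R)) (tagOf S n)
      (relOf S (fun a b => a = b)) ρ) ↔ Nonempty (M n ≃ₗ[R] (ℕ →₀ R)) := by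
    intro n
    rw [← exists_isPresentation_iff]
    refine exists_isPresentation_comp_iff (fun x : M n => ψ x) (fun b => ⟨fun h => ?_, ?_⟩) ?_
    · obtain ⟨a, rfl⟩ := ψ.surjective b
      exact ⟨⟨a, (htag n a).2 h⟩, rfl⟩
    · rintro ⟨a, rfl⟩
      exact (htag n a).1 a.2
    · rintro (_ | _ | _ | r) x y z <;>
        simp only [modRel, ← h0, ← hadd, ← hsmul, ψ.injective.eq_iff, Subtype.ext_iff] <;> rfl
  have e3 : ∀ n, (∃ ρ, IsPresentation (moduleRel R (ℕ →₀ R)) (fun _ => True)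
      (relOf S (tagCongr S n)) ρ) ↔ Nonempty ((V ⧸ M n) ≃ₗ[R] (ℕ →₀ R)) := by
    intro n
    rw [← exists_isPresentation_quotient_iff]
    refine exists_isPresentation_comp_iff ψ (fun b => ⟨fun _ => ψ.surjective b, fun _ => trivial⟩) ?_
    have key : ∀ a b, tagCongr S n (ψ a) (ψ b) ↔ a - b ∈ M n := by
      intro a b
      constructor
      · rintro ⟨d, hd, h⟩
        obtain ⟨d, rfl⟩ := ψ.surjective d
        rw [← hadd, ψ.injective.eq_iff] at h
        rw [h, add_sub_cancel_left]
        exact (htag n d).2 hd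
      · intro h
        exact ⟨ψ (a - b), (htag n _).1 h, by rw [← hadd, add_sub_cancel]⟩
    rintro (_ | _ | _ | r) x y z <;> simp only [modRel, ← h0, ← hadd, ← hsmul, key]
  have e4 : ∀ n, tagOf S n (zeroOf S) ∧
      (∀ a b, tagOf S n a → tagOf S n b → tagOf S n (addOf S a b)) ∧
      ∀ r a, tagOf S n a → tagOf S n (smulOf S r a) := by
    intro n
    refine ⟨by rw [← h0, ← htag]; exact zero_mem _, fun a b ha hb => ?_, fun r a ha => ?_⟩
    · obtain ⟨a, rfl⟩ := ψ.surjective a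
      obtain ⟨b, rfl⟩ := ψ.surjective b
      rw [← htag] at ha hb
      rw [← hadd, ← htag]
      exact add_mem ha hb
    · obtain ⟨a, rfl⟩ := ψ.surjective a
      rw [← htag] at ha
      rw [← hsmul, ← htag]
      exact Submodule.smul_mem _ r ha
  refine and_congr e1 (forall_congr' fun n => ?_)
  rw [e2, e3]
  exact and_iff_right (e4 n)

end Transfer

/-- In the first clause `.eq` is true equality, so the presentation is a bijection and the tags can
be pulled back to submodules of `ℕ →₀ R`. -/
theorem mem_freeLikeClass_iff (S : Str (taggedLanguage R)) :
    S ∈ freeLikeClass R ↔ IsFreeLikeStr S := by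
  constructor
  · rintro ⟨V, _, _, M, hM, hε⟩
    obtain ⟨ψ, h0, hadd, hsmul, htag⟩ := (nonempty_equiv_iff _ _).1 hε
    exact (isFreeLikeStr_iff_of_equiv M S ψ h0 hadd hsmul htag).2 hM
  · intro h
    obtain ⟨ρ, hρ⟩ := h.1
    choose f hf using hρ.total
    have finj : Function.Injective f := fun a b hab =>
      (hρ.rel_iff .eq _ _ _ _ _ _ (hf a) (hf b) (hf a)).1 hab
    have fsurj : Function.Surjective f := fun b => by
      obtain ⟨a, ha⟩ := hρ.onto b trivial
      exact ⟨a, (hρ.rel_iff .eq _ _ _ _ _ _ (hf a) ha ha).2 rfl⟩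
    have h0 : f 0 = zeroOf S := (hρ.rel_iff .zero _ _ _ _ _ _ (hf 0) (hf 0) (hf 0)).2 rfl
    have hadd : ∀ a b, f (a + b) = addOf S (f a) (f b) := fun a b =>
      ((hρ.rel_iff .add _ _ _ _ _ _ (hf a) (hf b) (hf (a + b))).2 rfl).symm
    have hsmul : ∀ (r : R) a, f (r • a) = smulOf S r (f a) := fun r a =>
      ((hρ.rel_iff (.smul r) _ _ _ _ _ _ (hf a) (hf (r • a)) (hf a)).2 rfl).symm
    let M : ℕ → Submodule R (ℕ →₀ R) := fun n =>
      { carrier := {a | tagOf S n (f a)}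
        zero_mem' := by
          change tagOf S n (f 0)
          rw [h0]; exact (h.2 n).1.1
        add_mem' := fun {a b} ha hb => by
          change tagOf S n (f (a + b))
          rw [hadd]; exact (h.2 n).1.2.1 _ _ ha hb
        smul_mem' := fun r a ha => by
          change tagOf S n (f (r • a))
          rw [hsmul]; exact (h.2 n).1.2.2 _ _ ha }
    let ψ := Equiv.ofBijective f ⟨finj, fsurj⟩
    refine ⟨ℕ →₀ R, inferInstance, inferInstance, M, ?_, ?_⟩
    · exact (isFreeLikeStr_iff_of_equiv M S ψ h0 hadd hsmul fun _ _ => Iff.rfl).1 h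
    · exact (nonempty_equiv_iff _ _).2 ⟨ψ, h0, hadd, hsmul, fun _ _ => Iff.rfl⟩

instance (L : FirstOrder.Language.{u, v}) : BorelSpace (Str L) := ⟨rfl⟩

theorem measurable_funMap {L : FirstOrder.Language.{u, v}} {n : ℕ} (f : L.Functions n) (x : Fin n → ℕ) :
    Measurable fun S : Str L => S.funMap f x :=
  measurable_to_countable' fun y => (TopologicalSpace.isOpen_generateFrom_of_mem
    (Or.inl (Or.inl ⟨n, f, x, y, rfl⟩))).measurableSet

theorem measurableSet_relMap {L : FirstOrder.Language.{u, v}} {n : ℕ} (r : L.Relations n) (x : Fin n → ℕ) :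
    MeasurableSet {S : Str L | S.RelMap r x} :=
  (TopologicalSpace.isOpen_generateFrom_of_mem (Or.inl (Or.inr ⟨n, r, x, rfl⟩))).measurableSet

theorem measurableSet_relOf {R : Type u} {C : Str (taggedLanguage R) → ℕ → ℕ → Prop}
    (hC : ∀ a b, MeasurableSet {S | C S a b}) (i : ModRel R) (a b c : ℕ) :
    MeasurableSet {S : Str (taggedLanguage R) | relOf S (C S) i a b c} := by
  have hC' : ∀ (f g : Str (taggedLanguage R) → ℕ), Measurable f → Measurable g →
      MeasurableSet {S | C S (f S) (g S)} := by
    intro f g hf hg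
    have : {S | C S (f S) (g S)} = {S | ∃ x y, f S = x ∧ g S = y ∧ C S x y} := by
      ext S; simp
    rw [this]
    simp only [measurableSet_setOfPred] at hC ⊢
    exact .exists fun x => .exists fun y =>
      (measurableSet_setOfPred.1 (measurableSet_eq_fun hf measurable_const)).and
        ((measurableSet_setOfPred.1 (measurableSet_eq_fun hg measurable_const)).and (hC x y))
  cases i with
  | eq => exact hC a b
  | zero => exact hC' _ _ measurable_const (measurable_funMap _ _)
  | add => exact hC' _ _ (measurable_funMap _ _) measurable_const
  | smul r => exact hC' _ _ (measurable_funMap _ _) measurable_const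

theorem isBorelClass_freeLikeClass [Countable R] : IsBorelClass (freeLikeClass R) := by
  constructor
  · have eq : freeLikeClass R = {S | IsFreeLikeStr S} := Set.ext mem_freeLikeClass_iff
    have hz : Measurable fun S : Str (taggedLanguage R) => zeroOf S := measurable_funMap _ _
    have ha : ∀ a b, Measurable fun S : Str (taggedLanguage R) => addOf S a b :=
      fun a b => measurable_funMap _ _
    have hs : ∀ r a, Measurable fun S : Str (taggedLanguage R) => smulOf S r a :=
      fun a b => measurable_funMap _ _
    have ht : ∀ n a, Measurable fun S : Str (taggedLanguage R) => tagOf S n a :=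
      fun n a => measurableSet_setOfPred.1 (measurableSet_relMap _ _)
    have ht' : ∀ n (f : Str (taggedLanguage R) → ℕ), Measurable f →
        Measurable fun S : Str (taggedLanguage R) => tagOf S n (f S) := by
      intro n f hf
      have : (fun S => tagOf S n (f S)) = fun S => ∃ x, f S = x ∧ tagOf S n x := by
        ext S; simp
      rw [this]
      exact .exists fun x =>
        (measurableSet_setOfPred.1 (measurableSet_eq_fun hf measurable_const)).and (ht n x)
    have he : ∀ a b : ℕ, MeasurableSet {S : Str (taggedLanguage R) | a = b} :=
      fun a b => MeasurableSet.const _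
    have hc : ∀ n a b, MeasurableSet {S : Str (taggedLanguage R) | tagCongr S n a b} := by
      intro n a b
      simp only [measurableSet_setOfPred, tagCongr]
      exact .exists fun d => (ht n d).and
        (measurableSet_setOfPred.1 (measurableSet_eq_fun measurable_const (ha b d)))
    have hT : ∀ b : ℕ, MeasurableSet {S : Str (taggedLanguage R) | True} :=
      fun _ => MeasurableSet.const _
    rw [eq]
    simp only [IsFreeLikeStr, measurableSet_setOfPred]
    refine .and ?_ (.forall fun n => .and (.and ?_ (.and ?_ ?_)) (.and ?_ ?_))
    · exact measurableSet_setOfPred.1 (measurableSet_isPresentation _ hT (measurableSet_relOf he))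
    · exact ht' n _ hz
    · exact .forall fun a => .forall fun b => (ht n a).imp ((ht n b).imp (ht' n _ (ha a b)))
    · exact .forall fun r => .forall fun a => (ht n a).imp (ht' n _ (hs r a))
    · exact measurableSet_setOfPred.1 (measurableSet_isPresentation _
        (fun b => measurableSet_setOfPred.2 (ht n b)) (measurableSet_relOf he))
    · exact measurableSet_setOfPred.1 (measurableSet_isPresentation _ hT
        (measurableSet_relOf (hc n)))
  · rintro S T ⟨ε⟩ ⟨V, _, _, M, hM, ⟨δ⟩⟩
    exact ⟨V, _, _, M, hM, ⟨@FirstOrder.Language.Equiv.comp _ _ _ (taggedStructure M) S ℕ T ε δ⟩⟩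

end BorelClass

/-! ### The tagged module attached to a family of sets of finite sequences -/

section Split

variable {R : Type u} [Ring R] {X : Type}

theorem nonempty_finsupp_equiv_nat (R : Type u) [Ring R] (X : Type) [Countable X] [Infinite X] :
    Nonempty ((X →₀ R) ≃ₗ[R] (ℕ →₀ R)) := by
  obtain ⟨_⟩ := nonempty_denumerable X
  exact ⟨Finsupp.domLCongr (Denumerable.eqv X)⟩

variable (N : (X →₀ R) →ₗ[R] (X →₀ R)) (A : Set X)

/-- The image of the span of `A` under the shear `1 + N`. -/
noncomputable def shearSpan : Submodule R (X →₀ R) :=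
  (Finsupp.supported R R A).comap (LinearMap.id - N)

variable {N A}

theorem mem_shearSpan_iff {v : X →₀ R} : v ∈ shearSpan N A ↔ ∀ z ∉ A, v z = N v z := by
  rw [shearSpan, Submodule.mem_comap, Finsupp.mem_supported']
  simp [sub_eq_zero]

theorem single_add_mem_shearSpan (hN : ∀ v, N (N v) = 0) {z : X} (hz : z ∈ A) :
    Finsupp.single z 1 + N (Finsupp.single z 1) ∈ shearSpan N A := by
  rw [mem_shearSpan_iff]
  intro z' hz'
  have : z ≠ z' := fun h => hz' (h ▸ hz)
  simp [hN, Finsupp.single_eq_of_ne this.symm]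

theorem shearSpan_le (hN : ∀ v, N (N v) = 0) {M : Submodule R (X →₀ R)}
    (h : ∀ z ∈ A, Finsupp.single z 1 + N (Finsupp.single z 1) ∈ M) : shearSpan N A ≤ M := by
  intro v hv
  have hv' : v - N v ∈ Finsupp.supported R R A := hv
  have hle : Finsupp.supported R R A ≤ M.comap (LinearMap.id + N) := by
    rw [Finsupp.supported_eq_span_single, Submodule.span_le]
    rintro _ ⟨z, hz, rfl⟩
    exact h z hz
  have := hle hv'
  simpa [hN] using this

/-- Since `N ∘ N = 0`, the maps `1 - N` and `1 + N` are mutually inverse. Thus the submodule is a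
coordinate submodule moved by an automorphism, and both it and its quotient are free on infinite
parts of the basis. -/
theorem shearSpan_equiv [Countable X] (hN : ∀ v, N (N v) = 0) (hA : A.Infinite) (hA' : Aᶜ.Infinite) :
    Nonempty (shearSpan N A ≃ₗ[R] (ℕ →₀ R)) ∧
      Nonempty (((X →₀ R) ⧸ shearSpan N A) ≃ₗ[R] (ℕ →₀ R)) := by
  classical
  have := hA.to_subtype
  have := hA'.to_subtype
  let e : (X →₀ R) ≃ₗ[R] (X →₀ R) := LinearEquiv.ofLinearMap (LinearMap.id - N) (LinearMap.id + N)
    (by ext1 z; simp [LinearMap.ext_iff, hN]) (by ext1 z; simp [LinearMap.ext_iff, hN])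
  have he : (shearSpan N A).map (e : (X →₀ R) →ₗ[R] (X →₀ R)) = Finsupp.supported R R A :=
    Submodule.map_comap_eq_of_surjective e.surjective _
  obtain ⟨e1⟩ := nonempty_finsupp_equiv_nat R A
  obtain ⟨e2⟩ := nonempty_finsupp_equiv_nat R (Aᶜ : Set X)
  refine ⟨⟨((e.ofSubmodules _ _ he).trans (Finsupp.supportedEquivFinsupp A)).trans e1⟩, ?_⟩
  let p : (X →₀ R) →ₗ[R] ((Aᶜ : Set X) →₀ R) := Finsupp.lsubtypeDomain (Aᶜ : Set X)
  have hp : Function.Surjective p := fun v => ⟨v.mapDomain Subtype.val, by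
    ext z
    exact Finsupp.mapDomain_apply Subtype.val_injective v z⟩
  have hker : Finsupp.supported R R A = LinearMap.ker p := by
    ext v
    simp only [Finsupp.mem_supported', LinearMap.mem_ker, Finsupp.ext_iff, Subtype.forall]
    rfl
  exact ⟨(((Submodule.Quotient.equiv _ _ e he).trans (Submodule.quotEquivOfEq _ _ hker)).trans
    (p.quotKerEquivOfSurjective hp)).trans e2⟩

end Split

section Vertices

variable {H : Type} [Group H] (θ : H →* Equiv.Perm ℕ)

/-- The action of `H` on the disjoint union of `H` and the finite sequences. -/
def shift (h : H) : H ⊕ List ℕ → H ⊕ List ℕ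
  | .inl k => .inl (h * k)
  | .inr l => .inr (l.map (θ h))

theorem shift_one (x : H ⊕ List ℕ) : shift θ 1 x = x := by
  cases x <;> simp [shift]

theorem shift_mul (h k : H) (x : H ⊕ List ℕ) : shift θ (h * k) x = shift θ h (shift θ k x) := by
  cases x <;> simp [shift, mul_assoc]

/-- The basis of the module: for every `n` a copy of `H` and a copy of `H ⊕ List ℕ`, and elements
`lim l` which stand for the constant sequences. -/
inductive Vertex (H : Type)
  | grp (n : ℕ) (h : H)
  | pt (n : ℕ) (x : H ⊕ List ℕ)
  | lim (l : List ℕ)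

instance [Countable H] : Countable (Vertex H) := by
  let f : (ℕ × H) ⊕ (ℕ × (H ⊕ List ℕ)) ⊕ List ℕ → Vertex H := fun
    | .inl p => .grp p.1 p.2
    | .inr (.inl p) => .pt p.1 p.2
    | .inr (.inr l) => .lim l
  have hf : Function.Surjective f := by
    rintro (⟨n, h⟩ | ⟨n, x⟩ | l)
    exacts [⟨.inl (n, h), rfl⟩, ⟨.inr (.inl (n, x)), rfl⟩, ⟨.inr (.inr l), rfl⟩]
  exact hf.countable

/-- Names of the distinguished submodules. -/
inductive TagName (R : Type u) (H : Type) (J : Type) : Type u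
  | base (n : ℕ)
  | proj (n : ℕ)
  | graph (n : ℕ) (x : H ⊕ List ℕ) (r : R)
  | code (j : J)

instance {R : Type u} {J : Type} [Countable R] [Countable H] [Countable J] :
    Countable (TagName R H J) := by
  let f : ℕ ⊕ ℕ ⊕ (ℕ × (H ⊕ List ℕ) × R) ⊕ J → TagName R H J := fun
    | .inl n => .base n
    | .inr (.inl n) => .proj n
    | .inr (.inr (.inl p)) => .graph p.1 p.2.1 p.2.2
    | .inr (.inr (.inr j)) => .code j
  have hf : Function.Surjective f := by
    rintro (n | n | ⟨n, x, r⟩ | j)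
    exacts [⟨.inl n, rfl⟩, ⟨.inr (.inl n), rfl⟩, ⟨.inr (.inr (.inl (n, x, r))), rfl⟩,
      ⟨.inr (.inr (.inr j)), rfl⟩]
  exact hf.countable

variable {R : Type u} [Ring R] {J : Type}

open Finsupp (single)

open Classical in
/-- The shears defining the distinguished submodules, on the basis. -/
noncomputable def shearFun : TagName R H J → Vertex H → (Vertex H →₀ R)
  | .proj n, .lim l => -single (.pt n (.inr l)) 1
  | .graph n x r, .grp m h => if m = n then single (.pt n (shift θ h x)) r else 0
  | _, _ => 0

/-- The shears defining the distinguished submodules. -/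
noncomputable def shear (t : TagName R H J) : (Vertex H →₀ R) →ₗ[R] (Vertex H →₀ R) :=
  Finsupp.linearCombination R (shearFun θ t)

/-- The parts of the basis defining the distinguished submodules. -/
def tagSupport (P : J → Set (List ℕ)) : TagName R H J → Set (Vertex H)
  | .base n => Set.range (.pt n)
  | .proj n => (Set.range (.pt n))ᶜ
  | .graph n _ _ => Set.range (.grp n)
  | .code j => (Vertex.lim '' (P j)ᶜ)ᶜ

/-- The distinguished submodules. -/
noncomputable def tagModule (P : J → Set (List ℕ)) (t : TagName R H J) :
    Submodule R (Vertex H →₀ R) :=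
  shearSpan (shear θ t) (tagSupport P t)

theorem shear_single (t : TagName R H J) (z : Vertex H) (r : R) :
    shear θ t (single z r) = r • shearFun θ t z := by
  simp [shear]

/-- Each shear takes values in the span of the points `pt`, which all shears annihilate. -/
theorem shear_shear (t : TagName R H J) (v : Vertex H →₀ R) : shear θ t (shear θ t v) = 0 := by
  have : shear θ t ∘ₗ shear θ t = 0 := by
    ext1 z
    ext1
    simp only [LinearMap.comp_apply, Finsupp.lsingle_apply, shear_single, one_smul]
    cases t <;> cases z <;> simp only [shearFun, map_zero, map_neg, shear_single, smul_zero,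
      neg_zero, LinearMap.zero_apply]
    split_ifs <;> simp [shear_single, shearFun]
  exact LinearMap.congr_fun this v

theorem tagModule_equiv [Infinite H] [Countable H] {P : J → Set (List ℕ)}
    (hP : ∀ j, (P j)ᶜ.Infinite) (t : TagName R H J) :
    Nonempty (tagModule θ P t ≃ₗ[R] (ℕ →₀ R)) ∧
      Nonempty (((Vertex H →₀ R) ⧸ tagModule θ P t) ≃ₗ[R] (ℕ →₀ R)) := by
  have hpt : ∀ n, (Set.range (Vertex.pt (H := H) n)).Infinite := fun n =>
    Set.infinite_range_of_injective fun x y h => by simpa using h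
  have hgrp : ∀ n, (Set.range (Vertex.grp (H := H) n)).Infinite := fun n =>
    Set.infinite_range_of_injective fun x y h => by simpa using h
  have hpt' : ∀ n, (Set.range (Vertex.pt (H := H) n))ᶜ.Infinite := fun n =>
    (hgrp 0).mono (by rintro _ ⟨h, rfl⟩; simp)
  refine shearSpan_equiv (shear_shear θ t) ?_ ?_
  · cases t with
    | base n => exact hpt n
    | proj n => exact hpt' n
    | graph n => exact hgrp n
    | code j => exact (hgrp 0).mono (by rintro _ ⟨h, rfl⟩; simp [tagSupport])
  · cases t with
    | base n => exact hpt' n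
    | proj n => simpa only [tagSupport, compl_compl] using hpt n
    | graph n => exact (hpt 0).mono (by rintro _ ⟨h, rfl⟩; simp [tagSupport])
    | code j =>
      simp only [tagSupport, compl_compl]
      exact (hP j).image fun x _ y _ h => by simpa using h

end Vertices

/-! ### From a permutation to an isomorphism of tagged modules -/

section Encode

open Finsupp (single)

variable {H : Type} [Group H] (θ : H →* Equiv.Perm ℕ) {R : Type u} [Ring R] {J : Type}

theorem single_add_mem_tagModule (P : J → Set (List ℕ)) (t : TagName R H J) {z : Vertex H}
    (hz : z ∈ tagSupport P t) : single z 1 + shearFun θ t z ∈ tagModule θ P t := by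
  have := single_add_mem_shearSpan (shear_shear θ t) hz
  rwa [shear_single, one_smul] at this

theorem tagModule_le {P : J → Set (List ℕ)} {t : TagName R H J}
    {M : Submodule R (Vertex H →₀ R)}
    (h : ∀ z ∈ tagSupport P t, single z 1 + shearFun θ t z ∈ M) : tagModule θ P t ≤ M := by
  refine shearSpan_le (shear_shear θ t) fun z hz => ?_
  rw [shear_single, one_smul]
  exact h z hz

/-- The image of the basis under the map given by a sequence `η` in `H` with limit `σ`. -/
noncomputable def limitFun (R : Type u) [Ring R] (η : ℕ → H) (σ : Equiv.Perm ℕ) (N : List ℕ → ℕ) :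
    Vertex H → (Vertex H →₀ R)
  | .grp n h => single (.grp n (η n * h)) 1
  | .pt n x => single (.pt n (shift θ (η n) x)) 1
  | .lim l => single (.lim (l.map σ)) 1 + ∑ n ∈ Finset.range (N l),
      (single (.pt n (.inr (l.map (θ (η n))))) 1 - single (.pt n (.inr (l.map σ))) 1)

/-- The linear map given by a sequence `η` in `H` with limit `σ`. -/
noncomputable def limitMap (R : Type u) [Ring R] (η : ℕ → H) (σ : Equiv.Perm ℕ) (N : List ℕ → ℕ) :
    (Vertex H →₀ R) →ₗ[R] (Vertex H →₀ R) :=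
  Finsupp.linearCombination R (limitFun θ R η σ N)

theorem limitMap_single (η : ℕ → H) (σ : Equiv.Perm ℕ) (N : List ℕ → ℕ) (z : Vertex H) (r : R) :
    limitMap θ R η σ N (single z r) = r • limitFun θ R η σ N z := by
  simp [limitMap]

/-- The two finite corrections of `lim l` cancel term by term; `hN` makes them run over the same
range. -/
theorem limitMap_inv_comp {η η' : ℕ → H} {σ σ' : Equiv.Perm ℕ} {N N' : List ℕ → ℕ}
    (hη : ∀ n, η' n * η n = 1) (hσ : σ' * σ = 1) (hN : ∀ l, N' (l.map σ) = N l) :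
    limitMap θ R η' σ' N' ∘ₗ limitMap θ R η σ N = LinearMap.id := by
  have hσ' : ∀ l : List ℕ, (l.map σ).map σ' = l := fun l => by
    rw [List.map_map, ← Equiv.Perm.coe_mul, hσ]; simp
  have hθ : ∀ n (l : List ℕ), (l.map (θ (η n))).map (θ (η' n)) = l := fun n l => by
    rw [List.map_map, ← Equiv.Perm.coe_mul, ← map_mul, hη]; simp
  ext1 z
  ext1
  simp only [LinearMap.comp_apply, Finsupp.lsingle_apply, limitMap_single, one_smul,
    LinearMap.id_apply]
  cases z with
  | grp n h => simp [limitFun, limitMap_single, ← mul_assoc, hη]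
  | pt n x => simp [limitFun, limitMap_single, ← shift_mul, hη, shift_one]
  | lim l =>
    simp only [limitFun, map_add, map_sum, map_sub, limitMap_single, one_smul, shift, hσ', hθ, hN]
    rw [add_assoc, ← Finset.sum_add_distrib]
    simp

theorem limitMap_mem {η : ℕ → H} {σ : Equiv.Perm ℕ} {N : List ℕ → ℕ} {P Q : J → Set (List ℕ)}
    (hN : ∀ l, ∀ n ≥ N l, l.map (θ (η n)) = l.map σ) (hPQ : ∀ j, ∀ l ∈ P j, l.map σ ∈ Q j)
    (t : TagName R H J) {v : Vertex H →₀ R} (hv : v ∈ tagModule θ P t) :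
    limitMap θ R η σ N v ∈ tagModule θ Q t := by
  have mem := fun {z : Vertex H} => single_add_mem_tagModule θ Q t (z := z)
  suffices tagModule θ P t ≤ (tagModule θ Q t).comap (limitMap θ R η σ N) from this hv
  refine tagModule_le θ fun z hz => ?_
  simp only [Submodule.mem_comap, map_add, limitMap_single, one_smul]
  cases t with
  | base n =>
    obtain ⟨x, rfl⟩ := hz
    simpa [limitFun, shearFun] using mem (z := .pt n (shift θ (η n) x)) ⟨_, rfl⟩
  | graph n x r =>
    obtain ⟨h, rfl⟩ := hz
    have := mem (z := .grp n (η n * h)) ⟨_, rfl⟩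
    simpa [limitFun, shearFun, limitMap_single, shift_mul] using this
  | code j =>
    cases z with
    | grp n h =>
      simpa [limitFun, shearFun] using mem (z := .grp n (η n * h)) (by simp [tagSupport])
    | pt n x =>
      simpa [limitFun, shearFun] using mem (z := .pt n (shift θ (η n) x)) (by simp [tagSupport])
    | lim l =>
      have hl : l ∈ P j := by simpa [tagSupport] using hz
      have h1 : ∀ n x, single (Vertex.pt n x) (1 : R) ∈ tagModule θ Q (.code j) := fun n x => by
        simpa [shearFun] using mem (z := .pt n x) (by simp [tagSupport])
      have h2 : single (.lim (l.map σ)) (1 : R) ∈ tagModule θ Q (.code j) := by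
        simpa [shearFun] using mem (z := .lim (l.map σ)) (by simpa [tagSupport] using hPQ j l hl)
      simp only [limitFun, shearFun, map_zero, add_zero]
      exact add_mem h2 (sum_mem fun n _ => sub_mem (h1 _ _) (h1 _ _))
  | proj n =>
    cases z with
    | grp m h =>
      simpa [limitFun, shearFun] using mem (z := .grp m (η m * h)) (by simp [tagSupport])
    | pt m x =>
      have hm : n ≠ m := by
        rintro rfl
        simp [tagSupport] at hz
      simpa [limitFun, shearFun] using
        mem (z := .pt m (shift θ (η m) x)) (by simp [tagSupport, hm])
    | lim l =>
      let D : ℕ → (Vertex H →₀ R) := fun m =>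
        single (.pt m (.inr (l.map (θ (η m))))) 1 - single (.pt m (.inr (l.map σ))) 1
      have hD : ∀ m, m ≠ n → D m ∈ tagModule θ Q (.proj n) := by
        intro m hm
        have h1 : ∀ x, single (Vertex.pt m x) (1 : R) ∈ tagModule θ Q (.proj n) := fun x => by
          simpa [shearFun] using mem (z := .pt m x) (by simp [tagSupport, hm.symm])
        exact sub_mem (h1 _) (h1 _)
      -- The image of `lim l - pt n l` is `lim (σ l) - pt n (σ l)` plus this difference. The term `D
      -- n` either cancels or, when `n ≥ N l`, vanishes.
      have hsum : ∑ m ∈ Finset.range (N l), D m - D n ∈ tagModule θ Q (.proj n) := by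
        by_cases hn : n ∈ Finset.range (N l)
        · rw [← Finset.sum_erase_eq_sub hn]
          exact sum_mem fun m hm => hD m (Finset.ne_of_mem_erase hm)
        · have hD0 : D n = 0 := by
            have := hN l n (by simpa using hn)
            simp [D, this]
          rw [hD0, sub_zero]
          exact sum_mem fun m hm => hD m fun h => hn (h ▸ hm)
      have h2 := mem (z := .lim (l.map σ)) (by simp [tagSupport])
      have := add_mem h2 hsum
      convert this using 1
      simp only [limitFun, shearFun, map_neg, limitMap_single, one_smul, shift, D]
      abel

/-- A permutation which carries the family `P` to the family `Q` induces an isomorphism of the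
tagged modules. -/
theorem exists_linearEquiv_of_perm
    (hθ : ∀ (σ : Equiv.Perm ℕ) (n : ℕ), ∃ h, ∀ i < n, θ h i = σ i)
    {P Q : J → Set (List ℕ)} (σ : Equiv.Perm ℕ) (hσ : ∀ j l, l ∈ P j ↔ l.map σ ∈ Q j) :
    ∃ g : (Vertex H →₀ R) ≃ₗ[R] (Vertex H →₀ R),
      ∀ t v, v ∈ tagModule θ P t ↔ g v ∈ tagModule θ Q t := by
  choose η hη using hθ σ
  -- Every entry of `l` is at most `l.sum`, while `η n` agrees with `σ` strictly below `n`.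
  let N : List ℕ → ℕ := fun l => l.sum + 1
  let N' : List ℕ → ℕ := fun l => N (l.map ⇑(σ⁻¹))
  have hN : ∀ l, ∀ n ≥ N l, l.map (θ (η n)) = l.map σ := fun l n hn =>
    List.map_congr_left fun i hi => hη n i (by
      have := List.single_le_sum (fun _ _ => Nat.zero_le _) i hi
      simp only [N] at hn
      omega)
  have hinv : ∀ l : List ℕ, (l.map ⇑(σ⁻¹)).map σ = l := fun l => by
    rw [List.map_map, ← Equiv.Perm.coe_mul, mul_inv_cancel]; simp
  have hinv' : ∀ l : List ℕ, (l.map σ).map ⇑(σ⁻¹) = l := fun l => by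
    rw [List.map_map, ← Equiv.Perm.coe_mul, inv_mul_cancel]; simp
  have hN' : ∀ l, ∀ n ≥ N' l, l.map (θ (η n)⁻¹) = l.map ⇑(σ⁻¹) := fun l n hn => by
    have := hN (l.map ⇑(σ⁻¹)) n hn
    rw [hinv] at this
    conv_lhs => rw [← this]
    rw [List.map_map, ← Equiv.Perm.coe_mul, ← map_mul, inv_mul_cancel]
    simp
  have c1 := limitMap_inv_comp θ (R := R) (η := η) (η' := fun n => (η n)⁻¹) (σ := σ) (σ' := σ⁻¹)
    (N := N) (N' := N') (by simp) (by simp) (fun l => by simp only [N', hinv'])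
  have c2 := limitMap_inv_comp θ (R := R) (η' := η) (η := fun n => (η n)⁻¹) (σ' := σ) (σ := σ⁻¹)
    (N' := N) (N := N') (by simp) (by simp) (fun l => rfl)
  refine ⟨LinearEquiv.ofLinearMap _ _ c2 c1, fun t v => ⟨fun h => ?_, fun h => ?_⟩⟩
  · exact limitMap_mem θ hN (fun j l hl => (hσ j l).1 hl) t h
  · have := limitMap_mem θ (P := Q) (Q := P) hN'
      (fun j l hl => (hσ j _).2 (by rwa [hinv])) t h
    have e := LinearMap.congr_fun c1 v
    rw [LinearMap.comp_apply, LinearMap.id_apply] at e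
    exact e ▸ this

end Encode

/-! ### Trivial units -/

section Units

open MonoidAlgebra

/-- Over a domain, group rings of groups with the two-unique-products property only have trivial
units. -/
theorem exists_eq_single_of_mul_eq_one {K H : Type*} [Ring K] [IsDomain K] [Group H]
    [TwoUniqueProds H] {a b : MonoidAlgebra K H} (h : b * a = 1) :
    ∃ (η : H) (c : K), c ≠ 0 ∧ a = MonoidAlgebra.single η c := by
  have ha : a ≠ 0 := by rintro rfl; simp at h
  have hb : b ≠ 0 := by rintro rfl; simp at h
  have pos : ∀ {x : MonoidAlgebra K H}, x ≠ 0 → 0 < x.coeff.support.card := fun hx =>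
    Finset.card_pos.2 (Finsupp.support_nonempty_iff.2 (by simpa using hx))
  -- A uniquely represented product has a nonzero coefficient in `b * a = 1`, so it must be the
  -- identity. Two such pairs would contradict uniqueness.
  have key : ∀ p : H × H, p ∈ b.coeff.support ×ˢ a.coeff.support →
      UniqueMul b.coeff.support a.coeff.support p.1 p.2 → p.1 * p.2 = 1 := by
    intro p hp hu
    rw [Finset.mem_product, Finsupp.mem_support_iff, Finsupp.mem_support_iff] at hp
    have := coeff_mul_mul_of_uniqueMul hu
    by_contra hne
    rw [h, one_def, coeff_single, Finsupp.single_eq_of_ne hne] at this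
    exact mul_ne_zero hp.1 hp.2 this.symm
  have hcard : ¬ 1 < b.coeff.support.card * a.coeff.support.card := by
    intro hlt
    obtain ⟨p, hp, q, hq, hne, hup, huq⟩ := TwoUniqueProds.uniqueMul_of_one_lt_card hlt
    rw [Finset.mem_product] at hq
    have := hup hq.1 hq.2 ((key q (Finset.mem_product.2 hq) huq).trans (key p hp hup).symm)
    exact hne (Prod.ext this.1.symm this.2.symm)
  have h1 : a.coeff.support.card = 1 := by
    have := pos ha
    have := pos hb
    nlinarith
  obtain ⟨η, hη⟩ := Finset.card_eq_one.1 h1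
  obtain ⟨hne, heq⟩ := Finsupp.support_eq_singleton.1 hη
  exact ⟨η, a.coeff η, hne, coeff_injective heq⟩

end Units

/-! ### From an isomorphism of tagged modules to a permutation -/

section Decode

open Finsupp (single)

variable {H : Type} [Group H] (θ : H →* Equiv.Perm ℕ) {R : Type u} [Ring R] {J : Type}

theorem grp_injective {H : Type} (n : ℕ) : Function.Injective (Vertex.grp (H := H) n) := fun x y h => by
  simpa using h

variable {θ} {P Q : J → Set (List ℕ)}

theorem apply_eq_of_mem_proj {n : ℕ} {v : Vertex H →₀ R} (hv : v ∈ tagModule θ P (.proj n))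
    (l : List ℕ) : v (.pt n (.inr l)) + v (.lim l) = 0 := by
  let ev : (Vertex H →₀ R) →ₗ[R] R := Finsupp.lapply (.pt n (.inr l)) + Finsupp.lapply (.lim l)
  suffices tagModule θ P (.proj n) ≤ LinearMap.ker ev from this hv
  refine tagModule_le θ fun z hz => ?_
  rw [LinearMap.mem_ker]
  classical
  cases z with
  | grp m h => simp [ev, shearFun]
  | pt m x =>
    have hm : n ≠ m := by
      rintro rfl
      simp [tagSupport] at hz
    simp [ev, shearFun, hm.symm]
  | lim l' =>
    simp only [ev, shearFun, LinearMap.add_apply, Finsupp.lapply_apply, Finsupp.add_apply,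
      Finsupp.neg_apply, Finsupp.single_apply]
    simp

theorem apply_eq_zero_of_mem_code {j : J} {v : Vertex H →₀ R} (hv : v ∈ tagModule θ P (.code j))
    {l : List ℕ} (hl : l ∉ P j) : v (.lim l) = 0 := by
  have := mem_shearSpan_iff.1 hv (.lim l) (by simpa [tagSupport] using hl)
  rw [this]
  have h0 : (shearFun θ (TagName.code j : TagName R H J)) = 0 := by
    funext z; cases z <;> rfl
  simp [shear, h0]

theorem apply_eq_zero_of_mem_base {n : ℕ} {v : Vertex H →₀ R} (hv : v ∈ tagModule θ P (.base n))
    {z : Vertex H} (hz : z ∉ Set.range (Vertex.pt (H := H) n)) : v z = 0 := by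
  have := mem_shearSpan_iff.1 hv z hz
  rw [this]
  have h0 : (shearFun θ (TagName.base n : TagName R H J)) = 0 := by
    funext z; cases z <;> rfl
  simp [shear, h0]

/-- With scalar `0` the graph tag is just the span of the `n`-th copy of `H`, so no separate tag for
it is needed. -/
theorem apply_eq_zero_of_mem_graph_zero {n : ℕ} {x : H ⊕ List ℕ} {v : Vertex H →₀ R}
    (hv : v ∈ tagModule θ P (.graph n x 0))
    {z : Vertex H} (hz : z ∉ Set.range (Vertex.grp (H := H) n)) : v z = 0 := by
  have := mem_shearSpan_iff.1 hv z hz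
  rw [this]
  have h0 : (shearFun θ (TagName.graph n x 0 : TagName R H J)) = 0 := by
    funext z; cases z <;> simp [shearFun]
  simp [shear, h0]

theorem single_mem_graph_zero (P : J → Set (List ℕ)) (n : ℕ) (h : H) (x : H ⊕ List ℕ) :
    single (.grp n h) (1 : R) ∈ tagModule θ P (.graph n x 0) := by
  simpa [shearFun] using single_add_mem_tagModule θ P (.graph n x (0 : R)) (z := .grp n h) ⟨h, rfl⟩

theorem single_mem_base (P : J → Set (List ℕ)) (n : ℕ) (x : H ⊕ List ℕ) (r : R) :
    single (.pt n x) r ∈ tagModule θ P (.base n : TagName R H J) := by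
  have := single_add_mem_tagModule θ P (.base n : TagName R H J) (z := .pt n x) ⟨x, rfl⟩
  simpa [shearFun] using Submodule.smul_mem _ r this

/-- An isomorphism of tagged modules acts on the `n`-th copy of `H ⊕ List ℕ` through its value at
the unit of the `n`-th copy of `H`. -/
theorem apply_single_pt {g : (Vertex H →₀ R) →ₗ[R] (Vertex H →₀ R)}
    (hg : ∀ t v, v ∈ tagModule θ P t → g v ∈ tagModule θ Q t) (n : ℕ) (x : H ⊕ List ℕ) (r : R) :
    g (single (.pt n x) r) =
      ((g (single (.grp n 1) 1)).comapDomain (.grp n) (grp_injective n).injOn).sum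
        fun h s => single (.pt n (shift θ h x)) (s * r) := by
  classical
  set a := g (single (.grp n 1) 1) with ha
  set b := g (single (.pt n x) r) with hb
  have ha0 : ∀ z ∉ Set.range (Vertex.grp (H := H) n), a z = 0 := fun z hz =>
    apply_eq_zero_of_mem_graph_zero (x := x) (hg _ _ (single_mem_graph_zero P n 1 x)) hz
  have hb0 : ∀ z ∉ Set.range (Vertex.pt (H := H) n), b z = 0 := fun z hz =>
    apply_eq_zero_of_mem_base (hg _ _ (single_mem_base P n x r)) hz
  -- Membership in the graph says that the point part `b` is the shear of the group part `a`; this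
  -- determines `b` from `a`.
  have hmem : a + b ∈ tagModule θ Q (.graph n x r) := by
    rw [ha, hb, ← map_add]
    refine hg _ _ ?_
    have := single_add_mem_tagModule θ P (.graph n x r) (z := .grp n 1) ⟨1, rfl⟩
    simpa [shearFun, shift_one] using this
  have hNb : shear θ (.graph n x r : TagName R H J) b = 0 := by
    rw [shear, Finsupp.linearCombination_apply]
    refine Finset.sum_eq_zero fun z hz => ?_
    obtain ⟨y, rfl⟩ : z ∈ Set.range (Vertex.pt (H := H) n) := by
      by_contra h
      exact Finsupp.mem_support_iff.1 hz (hb0 z h)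
    simp [shearFun]
  have hNa : shear θ (.graph n x r : TagName R H J) a =
      (a.comapDomain (.grp n) (grp_injective n).injOn).sum
        fun h s => single (.pt n (shift θ h x)) (s * r) := by
    have hmap : a = (a.comapDomain (.grp n) (grp_injective n).injOn).mapDomain (.grp n) := by
      ext z
      by_cases hz : z ∈ Set.range (Vertex.grp (H := H) n)
      · obtain ⟨h, rfl⟩ := hz
        rw [Finsupp.mapDomain_apply (grp_injective n)]
        rfl
      · rw [ha0 z hz, Finsupp.mapDomain_of_notMem_range _ _ hz]
    conv_lhs => rw [hmap]
    rw [shear, Finsupp.linearCombination_mapDomain, Finsupp.linearCombination_apply]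
    simp [shearFun]
  rw [← hNa]
  ext z
  by_cases hz : z ∈ Set.range (Vertex.pt (H := H) n)
  · obtain ⟨y, rfl⟩ := hz
    have := mem_shearSpan_iff.1 hmem (.pt n y) (by simp [tagSupport])
    rwa [map_add, hNb, add_zero, Finsupp.add_apply, ha0 _ (by simp), zero_add] at this
  · rw [hb0 z hz, hNa, Finsupp.sum, Finsupp.finsetSum_apply]
    refine (Finset.sum_eq_zero fun h _ => ?_).symm
    exact Finsupp.single_eq_of_ne (fun h' => hz ⟨_, h'.symm⟩)

/-- The coefficients of an isomorphism on the `n`-th copy of `H` are central. -/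
theorem apply_grp_mem_center {g : (Vertex H →₀ R) →ₗ[R] (Vertex H →₀ R)}
    (hg : ∀ t v, v ∈ tagModule θ P t → g v ∈ tagModule θ Q t) (n : ℕ) (h : H) :
    g (single (.grp n 1) 1) (.grp n h) ∈ Subring.center R := by
  classical
  -- Left translation on the copy of `H` is free, so exactly one summand contributes. Linearity
  -- gives the same coefficient with `r` on the left.
  have key : ∀ r : R, g (single (.pt n (.inl 1)) r) (.pt n (.inl h)) =
      g (single (.grp n 1) 1) (.grp n h) * r := by
    intro r
    rw [apply_single_pt hg, Finsupp.sum_apply, Finsupp.sum_eq_single h]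
    · simp [shift]
    · intro k _ hk
      simp [shift, hk]
    · simp
  rw [Subring.mem_center_iff]
  intro r
  rw [← key r, ← mul_one (g (single (.grp n 1) 1) (.grp n h)), ← key 1]
  have : single (Vertex.pt n (.inl (1 : H))) r = r • single (Vertex.pt n (.inl 1)) 1 := by simp
  rw [this, map_smul, Finsupp.smul_apply, smul_eq_mul]

open Classical in
/-- The element of the group ring of `H` over the center of `R` through which an isomorphism acts
on the `n`-th copy of `H`. -/
noncomputable def groupRingElement (g : (Vertex H →₀ R) →ₗ[R] (Vertex H →₀ R))
    (hc : ∀ n h, g (single (.grp n 1) 1) (.grp n h) ∈ Subring.center R) (n : ℕ) :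
    MonoidAlgebra (Subring.center R) H :=
  .ofCoeff (Finsupp.onFinset
    ((g (single (.grp n 1) 1)).comapDomain (.grp n) (grp_injective n).injOn).support
    (fun h => ⟨g (single (.grp n 1) 1) (.grp n h), hc n h⟩) fun h hh => by
      rw [Finsupp.mem_support_iff, Finsupp.comapDomain_apply]
      exact fun h0 => hh (Subtype.ext h0))

theorem apply_single_pt' {g : (Vertex H →₀ R) →ₗ[R] (Vertex H →₀ R)}
    (hg : ∀ t v, v ∈ tagModule θ P t → g v ∈ tagModule θ Q t)
    (hc : ∀ n h, g (single (.grp n 1) 1) (.grp n h) ∈ Subring.center R)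
    (n : ℕ) (x : H ⊕ List ℕ) (r : R) :
    g (single (.pt n x) r) = (groupRingElement g hc n).coeff.sum
        fun h s => single (.pt n (shift θ h x)) ((s : R) * r) := by
  rw [apply_single_pt hg, groupRingElement, Finsupp.onFinset_sum]
  · rfl
  · simp

/-- The group ring over the center as a set of vectors supported on the `n`-th copy of `H`. -/
noncomputable def embedGroupRing (R : Type u) [Ring R] (H : Type) [Group H] (n : ℕ) :
    MonoidAlgebra (Subring.center R) H →+ (Vertex H →₀ R) where
  toFun f := f.coeff.sum fun h s => single (.pt n (.inl h)) (s : R)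
  map_zero' := by simp
  map_add' f f' := by
    rw [MonoidAlgebra.coeff_add, Finsupp.sum_add_index'] <;> simp

theorem embedGroupRing_apply (n : ℕ) (f : MonoidAlgebra (Subring.center R) H) :
    embedGroupRing R H n f = f.coeff.sum fun h s => single (.pt n (.inl h)) (s : R) := rfl

theorem embedGroupRing_single (n : ℕ) (h : H) (s : Subring.center R) :
    embedGroupRing R H n (MonoidAlgebra.single h s) = single (.pt n (.inl h)) (s : R) := by
  rw [embedGroupRing_apply, MonoidAlgebra.coeff_single, Finsupp.sum_single_index (by simp)]

theorem embedGroupRing_injective (n : ℕ) : Function.Injective (embedGroupRing R H n) := by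
  classical
  have key : ∀ f h, embedGroupRing R H n f (.pt n (.inl h)) = (f.coeff h : R) := by
    intro f h
    rw [embedGroupRing_apply, Finsupp.sum_apply, Finsupp.sum_eq_single h]
    · simp
    · intro k _ hk
      simp [hk]
    · simp
  intro f f' h
  refine MonoidAlgebra.coeff_injective (Finsupp.ext fun k => Subtype.ext ?_)
  rw [← key, ← key, h]

/-- On the regular part of the points the isomorphism is left multiplication, so composing
isomorphisms multiplies their group ring elements and these are units. -/
theorem apply_embedGroupRing {g : (Vertex H →₀ R) →ₗ[R] (Vertex H →₀ R)}
    (hg : ∀ t v, v ∈ tagModule θ P t → g v ∈ tagModule θ Q t)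
    (hc : ∀ n h, g (single (.grp n 1) 1) (.grp n h) ∈ Subring.center R) (n : ℕ)
    (f : MonoidAlgebra (Subring.center R) H) :
    g (embedGroupRing R H n f) = embedGroupRing R H n (groupRingElement g hc n * f) := by
  induction f using MonoidAlgebra.induction_linear with
  | zero => simp
  | add f f' h h' => rw [map_add, map_add, h, h', mul_add, map_add]
  | single k s =>
    rw [embedGroupRing_single, apply_single_pt' hg hc, MonoidAlgebra.mul_def, map_finsuppSum]
    refine Finsupp.sum_congr fun h _ => ?_
    rw [MonoidAlgebra.coeff_single, Finsupp.sum_single_index (by simp), embedGroupRing_single]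
    rfl

theorem groupRingElement_mul {g g' : (Vertex H →₀ R) →ₗ[R] (Vertex H →₀ R)}
    (hg : ∀ t v, v ∈ tagModule θ P t → g v ∈ tagModule θ Q t)
    (hg' : ∀ t v, v ∈ tagModule θ Q t → g' v ∈ tagModule θ P t) (h : ∀ v, g' (g v) = v)
    (hc : ∀ n h, g (single (.grp n 1) 1) (.grp n h) ∈ Subring.center R)
    (hc' : ∀ n h, g' (single (.grp n 1) 1) (.grp n h) ∈ Subring.center R) (n : ℕ) :
    groupRingElement g' hc' n * groupRingElement g hc n = 1 := by
  apply embedGroupRing_injective (R := R) (H := H) n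
  rw [← apply_embedGroupRing hg' hc']
  conv_lhs => rw [← mul_one (groupRingElement g hc n)]
  rw [← apply_embedGroupRing hg hc, h]

/-- If the group ring elements of an isomorphism are trivial units modulo an ideal, then the
corresponding sequence in `H` converges. -/
theorem eventually_map_eq {K : Type*} [Ring K] (π : Subring.center R →+* K)
    {g : (Vertex H →₀ R) →ₗ[R] (Vertex H →₀ R)}
    (hg : ∀ t v, v ∈ tagModule θ P t → g v ∈ tagModule θ Q t)
    (hc : ∀ n h, g (single (.grp n 1) 1) (.grp n h) ∈ Subring.center R)
    {η : ℕ → H} {c : ℕ → K} (hc0 : ∀ n, c n ≠ 0)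
    (hη : ∀ n, MonoidAlgebra.mapRingHom H π (groupRingElement g hc n) =
      MonoidAlgebra.single (η n) (c n)) (l : List ℕ) :
    ∃ l' N, (∀ n ≥ N, l.map (θ (η n)) = l') ∧ ∀ j, l ∈ P j → l' ∈ Q j := by
  classical
  set γ := g (single (.lim l) 1) with hγ
  -- The image of a limit point has finite support, so it misses all sufficiently late point blocks.
  obtain ⟨N, hN⟩ : ∃ N, ∀ n ≥ N, ∀ x, γ (.pt n x) = 0 := by
    let idx : Vertex H → ℕ := fun
      | .pt n _ => n
      | _ => 0
    refine ⟨γ.support.sup idx + 1, fun n hn x => ?_⟩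
    by_contra h
    have := Finset.le_sup (f := idx) (Finsupp.mem_support_iff.2 h)
    exact lt_irrefl _ (lt_of_lt_of_le hn this)
  let s : ℕ → List ℕ → Subring.center R := fun n z =>
    (groupRingElement g hc n).coeff.sum fun h s => if l.map (θ h) = z then s else 0
  -- For such `n`, preservation of `lim l - pt n l` under `proj n` equates the limit coefficients of
  -- `γ`, which do not involve `n`, with the point coefficients of the image of `pt n l`.
  have hs : ∀ n ≥ N, ∀ z, γ (.lim z) = (s n z : R) := by
    intro n hn z
    have hmem : γ - g (single (.pt n (.inr l)) 1) ∈ tagModule θ Q (.proj n) := by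
      rw [hγ, ← map_sub]
      refine hg _ _ ?_
      have := single_add_mem_tagModule θ P (.proj n : TagName R H J) (z := .lim l)
        (by simp [tagSupport])
      simpa [shearFun, sub_eq_add_neg] using this
    have h1 := apply_eq_of_mem_proj hmem z
    have h2 : g (single (.pt n (.inr l)) 1) (.lim z) = 0 :=
      apply_eq_zero_of_mem_base (hg _ _ (single_mem_base P n (.inr l) 1)) (by simp)
    rw [Finsupp.sub_apply, Finsupp.sub_apply, hN n hn, h2, zero_sub, sub_zero] at h1
    rw [← neg_add_eq_zero.1 h1, apply_single_pt' hg hc, Finsupp.sum_apply]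
    simp only [s, Finsupp.sum, AddSubmonoidClass.coe_finsetSum]
    refine Finset.sum_congr rfl fun h _ => ?_
    simp only [shift, mul_one, Finsupp.single_apply, Vertex.pt.injEq, Sum.inr.injEq, true_and]
    split_ifs <;> rfl
  -- Modulo the ideal only `η n` survives, so independence of `n` pins down `η n l`.
  have hπ : ∀ n z, π (s n z) = if l.map (θ (η n)) = z then c n else 0 := by
    intro n z
    have : π (s n z) = (MonoidAlgebra.mapRingHom H π (groupRingElement g hc n)).coeff.sum
        fun h s => if l.map (θ h) = z then s else 0 := by
      have hmap : (MonoidAlgebra.mapRingHom H π (groupRingElement g hc n)).coeff =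
          (groupRingElement g hc n).coeff.mapRange π (map_zero π) := by
        ext h
        rw [MonoidAlgebra.coeff_mapRingHom, Finsupp.mapRange_apply]
      rw [hmap, Finsupp.sum_mapRange_index (by simp), map_finsuppSum]
      refine Finsupp.sum_congr fun h _ => ?_
      split_ifs <;> simp
    rw [this, hη, MonoidAlgebra.coeff_single, Finsupp.sum_single_index (by simp)]
  refine ⟨l.map (θ (η N)), N, fun n hn => ?_, fun j hl => ?_⟩
  · by_contra hne
    have h1 : s n (l.map (θ (η N))) = s N (l.map (θ (η N))) := Subtype.ext
      ((hs n hn _).symm.trans (hs N le_rfl _))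
    have h2 := congrArg π h1
    rw [hπ, hπ, if_neg hne, if_pos rfl] at h2
    exact hc0 N h2.symm
  · by_contra hne
    have h1 : γ ∈ tagModule θ Q (.code j) := by
      refine hg _ _ ?_
      simpa [shearFun] using single_add_mem_tagModule θ P (.code j : TagName R H J) (z := .lim l)
        (by simpa [tagSupport] using hl)
    have h2 := apply_eq_zero_of_mem_code h1 hne
    rw [hs N le_rfl] at h2
    have h3 := hπ N (l.map (θ (η N)))
    rw [if_pos rfl, show s N (l.map (θ (η N))) = 0 from Subtype.ext h2, map_zero] at h3
    exact hc0 N h3.symm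

/-- An isomorphism of the tagged modules yields a permutation which carries the family `P` to the
family `Q`. -/
theorem exists_perm_of_linearEquiv [Nontrivial R] [TwoUniqueProds H]
    (g : (Vertex H →₀ R) ≃ₗ[R] (Vertex H →₀ R))
    (hg : ∀ t v, v ∈ tagModule θ P t ↔ g v ∈ tagModule θ Q t) :
    ∃ σ : Equiv.Perm ℕ, ∀ j l, l ∈ P j ↔ l.map σ ∈ Q j := by
  -- The center is commutative and nontrivial, so it has a residue field; this brings an arbitrary
  -- `R` within reach of the theorem on trivial units over a domain.
  obtain ⟨m, hm⟩ := Ideal.exists_maximal (Subring.center R)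
  let K := Subring.center R ⧸ m
  let π : Subring.center R →+* K := Ideal.Quotient.mk m
  have hg1 : ∀ t v, v ∈ tagModule θ P t → (g : (Vertex H →₀ R) →ₗ[R] (Vertex H →₀ R)) v ∈
      tagModule θ Q t := fun t v => (hg t v).1
  have hg2 : ∀ t v, v ∈ tagModule θ Q t →
      (g.symm : (Vertex H →₀ R) →ₗ[R] (Vertex H →₀ R)) v ∈ tagModule θ P t := fun t v hv =>
    (hg t _).2 (by simpa using hv)
  have hc1 := apply_grp_mem_center hg1
  have hc2 := apply_grp_mem_center hg2
  have m1 := fun n => congrArg (MonoidAlgebra.mapRingHom H π)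
    (groupRingElement_mul hg1 hg2 (by simp) hc1 hc2 n)
  have m2 := fun n => congrArg (MonoidAlgebra.mapRingHom H π)
    (groupRingElement_mul hg2 hg1 (by simp) hc2 hc1 n)
  simp only [map_mul, map_one] at m1 m2
  choose η c hc0 hη using fun n => exists_eq_single_of_mul_eq_one (m1 n)
  choose ζ d hd0 hζ using fun n => exists_eq_single_of_mul_eq_one (m2 n)
  have inv : ∀ n, ζ n * η n = 1 := by
    intro n
    have := m1 n
    rw [hη, hζ, MonoidAlgebra.single_mul_single, MonoidAlgebra.one_def,
      MonoidAlgebra.single_inj] at this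
    rcases this with h | h
    · exact h.1
    · exact absurd h.2 one_ne_zero
  have lim1 := eventually_map_eq π hg1 hc1 hc0 hη
  have lim2 := eventually_map_eq π hg2 hc2 hd0 hζ
  -- Singleton sequences give the pointwise limits; `headI` reads off the single entry, and its
  -- default value never matters.
  choose σ' hσ' using fun i : ℕ => lim1 [i]
  choose τ' hτ' using fun i : ℕ => lim2 [i]
  let σ : ℕ → ℕ := fun i => (σ' i).headI
  let τ : ℕ → ℕ := fun i => (τ' i).headI
  have hσ : ∀ i, ∀ᶠ n in Filter.atTop, θ (η n) i = σ i := fun i => by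
    obtain ⟨N, hN, -⟩ := hσ' i
    filter_upwards [Filter.eventually_ge_atTop N] with n hn
    simp [σ, ← hN n hn]
  have hτ : ∀ i, ∀ᶠ n in Filter.atTop, θ (ζ n) i = τ i := fun i => by
    obtain ⟨N, hN, -⟩ := hτ' i
    filter_upwards [Filter.eventually_ge_atTop N] with n hn
    simp [τ, ← hN n hn]
  have inv1 : ∀ n i, θ (ζ n) (θ (η n) i) = i := fun n i => by
    rw [← Equiv.Perm.mul_apply, ← map_mul, inv, map_one, Equiv.Perm.one_apply]
  have inv2 : ∀ n i, θ (η n) (θ (ζ n) i) = i := fun n i => by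
    rw [← Equiv.Perm.mul_apply, ← map_mul, mul_eq_one_comm.1 (inv n), map_one,
      Equiv.Perm.one_apply]
  have e1 : ∀ i, τ (σ i) = i := fun i => by
    obtain ⟨n, h1, h2⟩ := ((hσ i).and (hτ (σ i))).exists
    rw [← h2, ← h1, inv1]
  have e2 : ∀ i, σ (τ i) = i := fun i => by
    obtain ⟨n, h1, h2⟩ := ((hτ i).and (hσ (τ i))).exists
    rw [← h2, ← h1, inv2]
  have lists : ∀ {ξ : ℕ → H} {ρ : ℕ → ℕ},
      (∀ i, ∀ᶠ n in Filter.atTop, θ (ξ n) i = ρ i) → ∀ l : List ℕ,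
      ∀ᶠ n in Filter.atTop, l.map (θ (ξ n)) = l.map ρ := by
    intro ξ ρ h l
    induction l with
    | nil => simp
    | cons i l ih =>
      filter_upwards [h i, ih] with n h1 h2
      simp [h1, h2]
  have fwd : ∀ j, ∀ l ∈ P j, l.map σ ∈ Q j := by
    intro j l hl
    obtain ⟨l', N, h1, h2⟩ := lim1 l
    obtain ⟨n, h3, h4⟩ := ((lists hσ l).and (Filter.eventually_ge_atTop N)).exists
    rw [← h3, h1 n h4]
    exact h2 j hl
  have bwd : ∀ j, ∀ l ∈ Q j, l.map τ ∈ P j := by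
    intro j l hl
    obtain ⟨l', N, h1, h2⟩ := lim2 l
    obtain ⟨n, h3, h4⟩ := ((lists hτ l).and (Filter.eventually_ge_atTop N)).exists
    rw [← h3, h1 n h4]
    exact h2 j hl
  refine ⟨⟨σ, τ, e1, e2⟩, fun j l => ⟨fwd j l, fun h => ?_⟩⟩
  have := bwd j _ h
  rw [List.map_map] at this
  have hid : τ ∘ σ = id := funext e1
  simpa [hid] using this

end Decode

/-! ### Borel completeness -/

section Coding

variable {L : FirstOrder.Language.{0, 0}}

/-- The graphs of the basic functions and relations, as sets of finite sequences. -/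
def graphCode (S : Str L) : L.Symbols → Set (List ℕ)
  | .inl f => {l | ∃ x : Fin f.1 → ℕ, l = S.funMap f.2 x :: List.ofFn x}
  | .inr r => {l | ∃ x : Fin r.1 → ℕ, l = List.ofFn x ∧ S.RelMap r.2 x}

/-- All sequences coding one symbol have the same length, so longer ones are omitted. Without this
the quotient by a code tag could have finite rank. -/
theorem infinite_compl_graphCode (S : Str L) (j : L.Symbols) : (graphCode S j)ᶜ.Infinite := by
  obtain ⟨m, hm⟩ : ∃ m, ∀ l ∈ graphCode S j, l.length = m := by
    rcases j with f | r
    · exact ⟨f.1 + 1, by rintro _ ⟨x, rfl⟩; simp⟩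
    · exact ⟨r.1, by rintro _ ⟨x, rfl, -⟩; simp⟩
  refine (Set.infinite_range_of_injective (f := fun k : ℕ => List.replicate (m + 1 + k) 0)
    fun a b h => ?_).mono ?_
  · simpa using congrArg List.length h
  · rintro _ ⟨k, rfl⟩ h
    have := hm _ h
    simp at this
    omega

theorem measurableSet_graphCode (j : L.Symbols) (l : List ℕ) :
    MeasurableSet {S : Str L | l ∈ graphCode S j} := by
  rcases j with f | r
  · have : {S : Str L | l ∈ graphCode S (.inl f)} =
        ⋃ x : Fin f.1 → ℕ, (fun S : Str L => S.funMap f.2 x) ⁻¹' {y | l = y :: List.ofFn x} := by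
      ext S
      simp [graphCode]
    rw [this]
    exact .iUnion fun x => measurable_funMap _ _ (MeasurableSet.of_discrete)
  · have : {S : Str L | l ∈ graphCode S (.inr r)} =
        ⋃ x : Fin r.1 → ℕ, {S : Str L | l = List.ofFn x} ∩ {S : Str L | S.RelMap r.2 x} := by
      ext S
      simp [graphCode]
    rw [this]
    exact .iUnion fun x => (MeasurableSet.const _).inter (measurableSet_relMap _ _)

/-- A function code lists the value before the arguments. Injectivity of `List.ofFn` recovers the
arguments of the image, which forces `σ` to commute with the function. -/
theorem strIso_iff_graphCode (S T : Str L) :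
    StrIso S T ↔ ∃ σ : Equiv.Perm ℕ, ∀ j l, l ∈ graphCode S j ↔ l.map σ ∈ graphCode T j := by
  constructor
  · rintro ⟨ε⟩
    obtain ⟨σ, hf, hr⟩ : ∃ σ : Equiv.Perm ℕ,
        (∀ {n} (f : L.Functions n) x, σ (S.funMap f x) = T.funMap f (σ ∘ x)) ∧
        ∀ {n} (r : L.Relations n) x, T.RelMap r (σ ∘ x) ↔ S.RelMap r x :=
      ⟨@FirstOrder.Language.Equiv.toEquiv L ℕ ℕ S T ε,
        @FirstOrder.Language.Equiv.map_fun' L ℕ ℕ S T ε,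
        @FirstOrder.Language.Equiv.map_rel' L ℕ ℕ S T ε⟩
    refine ⟨σ, fun j l => ?_⟩
    have hinj : Function.Injective (List.map σ) := List.map_injective_iff.2 σ.injective
    have hx : ∀ {n} (x : Fin n → ℕ), ∃ y, σ ∘ y = x := fun x =>
      ⟨σ.symm ∘ x, by ext; simp⟩
    rcases j with f | r
    · constructor
      · rintro ⟨x, rfl⟩
        exact ⟨σ ∘ x, by simp [hf, List.map_ofFn]⟩
      · rintro ⟨x, h⟩
        obtain ⟨y, rfl⟩ := hx x
        exact ⟨y, hinj (by simp [h, hf, List.map_ofFn])⟩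
    · constructor
      · rintro ⟨x, rfl, h⟩
        exact ⟨σ ∘ x, by simp [List.map_ofFn], (hr _ _).2 h⟩
      · rintro ⟨x, h, h'⟩
        obtain ⟨y, rfl⟩ := hx x
        exact ⟨y, hinj (by simp [h, List.map_ofFn]), (hr _ _).1 h'⟩
  · rintro ⟨σ, hσ⟩
    refine ⟨@FirstOrder.Language.Equiv.mk L ℕ ℕ S T σ ?_ ?_⟩
    · intro n f x
      obtain ⟨y, hy⟩ := (hσ (.inl ⟨n, f⟩) _).1 ⟨x, rfl⟩
      simp only [List.map_cons, List.map_ofFn, List.cons.injEq] at hy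
      obtain rfl := List.ofFn_injective hy.2
      exact hy.1
    · intro n r x
      constructor
      · intro h
        obtain ⟨y, hy, hy'⟩ := (hσ (.inr ⟨n, r⟩) (List.ofFn x)).2
          ⟨σ ∘ x, by simp [List.map_ofFn], h⟩
        obtain rfl := List.ofFn_injective hy
        exact hy'
      · intro h
        obtain ⟨y, hy, hy'⟩ := (hσ (.inr ⟨n, r⟩) (List.ofFn x)).1 ⟨x, rfl, h⟩
        rw [List.map_ofFn] at hy
        obtain rfl := List.ofFn_injective hy
        exact hy'

end Coding

/-! ### The Borel reduction -/

section Reduction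

instance {R : Type u} (n : ℕ) [Countable R] : Countable ((taggedLanguage R).Functions n) := by
  let f : ModFunc R n → Option R := fun
    | .zero => none
    | .add => none
    | .smul r => some r
  have hf : Function.Injective f := by
    rintro (_ | _ | r) y h
    · cases y; rfl
    · cases y; rfl
    · cases y; simpa [f] using h
  exact hf.countable

instance {R : Type u} (n : ℕ) : Countable ((taggedLanguage R).Relations n) := by
  let f : TagRel n → ℕ := fun
    | .tag m => m
  have hf : Function.Injective f := by
    rintro ⟨m⟩ ⟨k⟩ h
    exact congrArg TagRel.tag h
  exact hf.countable

/-- A countable `R` makes the defining subbasis countable, so it generates the Borel `σ`-algebra and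
preimages need checking only on it. -/
theorem measurable_str_of_generators {R : Type u} {𝒳 : Type*} [MeasurableSpace 𝒳] [Countable R]
    (F : 𝒳 → Str (taggedLanguage R))
    (hf : ∀ (n : ℕ) (f : (taggedLanguage R).Functions n) (x : Fin n → ℕ) (y : ℕ),
      MeasurableSet {a | (F a).funMap f x = y})
    (hr : ∀ (n : ℕ) (r : (taggedLanguage R).Relations n) (x : Fin n → ℕ),
      MeasurableSet {a | (F a).RelMap r x}) : Measurable F := by
  let 𝓑 : Set (Set (Str (taggedLanguage R))) :=
    ({A | ∃ (n : ℕ) (f : (taggedLanguage R).Functions n) (x : Fin n → ℕ) (y : ℕ),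
        A = {S : Str (taggedLanguage R) | S.funMap f x = y}} ∪
     {A | ∃ (n : ℕ) (r : (taggedLanguage R).Relations n) (x : Fin n → ℕ),
        A = {S : Str (taggedLanguage R) | S.RelMap r x}} ∪
     {A | ∃ (n : ℕ) (r : (taggedLanguage R).Relations n) (x : Fin n → ℕ),
        A = {S : Str (taggedLanguage R) | ¬ S.RelMap r x}})
  have hcount : 𝓑.Countable := by
    refine ((Set.Countable.mono ?_ (Set.countable_range fun p : Σ n,
        (taggedLanguage R).Functions n × (Fin n → ℕ) × ℕ =>
        {S : Str (taggedLanguage R) | S.funMap p.2.1 p.2.2.1 = p.2.2.2})).union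
      (Set.Countable.mono ?_ (Set.countable_range fun p : Σ n,
        (taggedLanguage R).Relations n × (Fin n → ℕ) =>
        {S : Str (taggedLanguage R) | S.RelMap p.2.1 p.2.2}))).union
      (Set.Countable.mono ?_ (Set.countable_range fun p : Σ n,
        (taggedLanguage R).Relations n × (Fin n → ℕ) =>
        {S : Str (taggedLanguage R) | ¬ S.RelMap p.2.1 p.2.2}))
    · rintro _ ⟨n, f, x, y, rfl⟩
      exact ⟨⟨n, f, x, y⟩, rfl⟩
    · rintro _ ⟨n, r, x, rfl⟩
      exact ⟨⟨n, r, x⟩, rfl⟩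
    · rintro _ ⟨n, r, x, rfl⟩
      exact ⟨⟨n, r, x⟩, rfl⟩
  have : SecondCountableTopology (Str (taggedLanguage R)) := ⟨𝓑, hcount, rfl⟩
  have eq : instMeasurableSpaceStr (taggedLanguage R) = MeasurableSpace.generateFrom 𝓑 :=
    borel_eq_generateFrom_of_subbasis rfl
  rw [eq]
  refine measurable_generateFrom ?_
  rintro _ ((⟨n, f, x, y, rfl⟩ | ⟨n, r, x, rfl⟩) | ⟨n, r, x, rfl⟩)
  · exact hf n f x y
  · exact hr n r x
  · exact (hr n r x).compl

variable {R : Type u} [Ring R]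

/-- The copy on `ω` of a tagged module. -/
abbrev transportStr {V : Type v} [AddCommGroup V] [Module R V] (e : V ≃ ℕ) (M : ℕ → Submodule R V) :
    Str (taggedLanguage R) :=
  @Equiv.inducedStructure (taggedLanguage R) V ℕ (taggedStructure M) e

theorem nonempty_equiv_transportStr {V : Type v} [AddCommGroup V] [Module R V] (e : V ≃ ℕ)
    (M : ℕ → Submodule R V) :
    Nonempty (@FirstOrder.Language.Equiv (taggedLanguage R) V ℕ (taggedStructure M)
      (transportStr e M)) :=
  ⟨@Equiv.inducedStructureEquiv (taggedLanguage R) V ℕ (taggedStructure M) e⟩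

theorem strIso_transportStr_iff {V : Type v} [AddCommGroup V] [Module R V] (e : V ≃ ℕ)
    (M M' : ℕ → Submodule R V) : StrIso (transportStr e M) (transportStr e M') ↔
      ∃ g : V ≃ₗ[R] V, ∀ n v, v ∈ M n ↔ g v ∈ M' n := by
  have h1 : StrIso (transportStr e M) (transportStr e M') ↔
      Nonempty (@FirstOrder.Language.Equiv (taggedLanguage R) V V (taggedStructure M)
        (taggedStructure M')) := by
    obtain ⟨i⟩ := nonempty_equiv_transportStr e M
    obtain ⟨i'⟩ := nonempty_equiv_transportStr e M'
    constructor
    · rintro ⟨ε⟩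
      exact ⟨@FirstOrder.Language.Equiv.comp _ _ _ (taggedStructure M) (transportStr e M') _
        (taggedStructure M') (@FirstOrder.Language.Equiv.symm _ _ _ (taggedStructure M')
          (transportStr e M') i') (@FirstOrder.Language.Equiv.comp _ _ _ (taggedStructure M)
          (transportStr e M) _ (transportStr e M') ε i)⟩
    · rintro ⟨ε⟩
      exact ⟨@FirstOrder.Language.Equiv.comp _ _ _ (transportStr e M) (taggedStructure M') _
        (transportStr e M') i' (@FirstOrder.Language.Equiv.comp _ _ _ (transportStr e M)
          (taggedStructure M) _ (taggedStructure M') ε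
          (@FirstOrder.Language.Equiv.symm _ _ _ (taggedStructure M) (transportStr e M) i))⟩
  rw [h1, nonempty_equiv_iff]
  constructor
  · rintro ⟨ψ, -, hadd, hsmul, htag⟩
    exact ⟨{ ψ with map_add' := hadd, map_smul' := hsmul }, htag⟩
  · rintro ⟨g, hg⟩
    exact ⟨g.toEquiv, map_zero g, map_add g, map_smul g, hg⟩

/-- Only the code tags depend on the family, and there membership is a countable intersection of
conditions on single sequences. -/
theorem measurableSet_mem_tagModule {H J 𝒳 : Type} [Group H] [MeasurableSpace 𝒳]
    (θ : H →* Equiv.Perm ℕ) (P : 𝒳 → J → Set (List ℕ))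
    (hP : ∀ j l, MeasurableSet {a | l ∈ P a j}) (t : TagName R H J) (v : Vertex H →₀ R) :
    MeasurableSet {a | v ∈ tagModule θ (P a) t} := by
  cases t with
  | base n => exact MeasurableSet.const (v ∈ tagModule θ (fun _ : J => ∅) (.base n))
  | proj n => exact MeasurableSet.const (v ∈ tagModule θ (fun _ : J => ∅) (.proj n))
  | graph n x r => exact MeasurableSet.const (v ∈ tagModule θ (fun _ : J => ∅) (.graph n x r))
  | code j =>
    have : {a | v ∈ tagModule θ (P a) (.code j)} =
        ⋂ l, {a | l ∈ P a j} ∪ {a | v (.lim l) = shear θ (.code j : TagName R H J) v (.lim l)} := by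
      ext a
      simp only [tagModule, mem_shearSpan_iff, tagSupport, Set.mem_compl_iff, not_not, Set.mem_image,
        Set.mem_ofPred_eq, Set.mem_iInter, Set.mem_union, forall_exists_index, and_imp,
        forall_apply_eq_imp_iff₂]
      exact forall_congr' fun l => or_iff_not_imp_left.symm
    rw [this]
    exact .iInter fun l => (hP j l).union (MeasurableSet.const _)

theorem borelComplete_freeLikeClass [Countable R] [Nontrivial R] :
    BorelComplete (freeLikeClass R) := by
  refine ⟨isBorelClass_freeLikeClass, fun L _ C _ => ?_⟩
  obtain ⟨H, _, θ, _, _, hθ⟩ := exists_dense_group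
  have : Infinite H := by
    -- The element `h k` moves `0` to `k`, so these elements are distinct.
    choose h hh using fun k : ℕ => hθ (Equiv.swap 0 k) 1
    refine Infinite.of_injective h fun a b hab => ?_
    have := (hh a 0 one_pos).symm.trans (hab ▸ hh b 0 one_pos)
    simpa using this
  have : Infinite (Vertex H) := Infinite.of_injective Vertex.lim fun a b h => by simpa using h
  obtain ⟨eV⟩ := nonempty_finsupp_equiv_nat R (Vertex H)
  have : Infinite (Vertex H →₀ R) :=
    Infinite.of_injective (fun z => Finsupp.single z (1 : R)) fun a b h => by
      simpa using Finsupp.single_left_injective one_ne_zero h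
  obtain ⟨e⟩ : Nonempty ((Vertex H →₀ R) ≃ ℕ) := nonempty_equiv_of_countable
  have : Nonempty (TagName R H L.Symbols) := ⟨.base 0⟩
  obtain ⟨t, ht⟩ := exists_surjective_nat (TagName R H L.Symbols)
  let M : Str L → ℕ → Submodule R (Vertex H →₀ R) := fun S n => tagModule θ (graphCode S) (t n)
  have hM : ∀ S, transportStr e (M S) ∈ freeLikeClass R := fun S =>
    ⟨Vertex H →₀ R, inferInstance, inferInstance, M S,
      ⟨⟨eV⟩, fun n => tagModule_equiv θ (infinite_compl_graphCode S) (t n)⟩,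
      nonempty_equiv_transportStr e (M S)⟩
  have hmeas : Measurable fun S : Str L => transportStr e (M S) := by
    refine measurable_str_of_generators _ (fun n f x y => ?_) (fun n r x => ?_)
    -- The underlying module does not depend on `S`; only the tags vary.
    · have : ∀ S, (transportStr e (M S)).funMap f x =
          (transportStr e fun _ => (⊥ : Submodule R (Vertex H →₀ R))).funMap f x := by
        intro S
        cases f <;> rfl
      simp only [this]
      exact MeasurableSet.const _
    · cases r with
      | tag n => exact measurableSet_mem_tagModule θ _ measurableSet_graphCode (t n) (e.symm (x 0))
  refine ⟨fun S => ⟨transportStr e (M S), hM S⟩,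
    (hmeas.comp measurable_subtype_coe).subtype_mk, fun S T => ?_⟩
  change StrIso (transportStr e (M S)) (transportStr e (M T)) ↔ _
  rw [strIso_transportStr_iff, strIso_iff_graphCode]
  constructor
  · rintro ⟨g, hg⟩
    refine exists_perm_of_linearEquiv (θ := θ) g fun s v => ?_
    obtain ⟨n, rfl⟩ := ht s
    exact hg n v
  · rintro ⟨σ, hσ⟩
    obtain ⟨g, hg⟩ := exists_linearEquiv_of_perm θ (R := R) hθ σ hσ
    exact ⟨g, fun n v => hg (t n) v⟩

end Reduction

end TaggedModules

theorem mainTheorem11 {R : Type*} [Ring R] [Countable R] [Nontrivial R] :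
    TaggedModules.BorelComplete (TaggedModules.freeLikeClass R) :=
  TaggedModules.borelComplete_freeLikeClass
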